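/- Setting. Let $\mathcal X$ be a measurable space, $\mathcal F$ a class of measurable hypotheses $f:\mathcal X\to\{0,1\}$ of VC dimension $d$, and let $D_1,\dots,D_k$ ($k\ge 1$) be arbitrary probability distributions on $\mathcal X\times\{0,1\}$. Write $\mathrm{err}_D(f)=\Pr_{(x,y)\sim D}[f(x)\ne y]$, let $\mathrm{err}_S(f)$ be the fraction of mistakes of $f$ on a finite sample $S$, and let $\mathrm{OPT}=\inf_{f\in\mathcal F}\max_{i}\mathrm{err}_{D_i}(f)$ (not assumed to be $0$). Algorithm NR2, with parameters $\epsilon,\delta\in(0,1)$, $5\epsilon/4<\alpha<1$ and constants $C_1,C_2>0$. Put $\alpha'=\alpha/40$, $\epsilon'=\epsilon/64$, $t=2\lceil \ln(4k/\delta)/\alpha'^3\rceil$, $\delta'=\delta/(4t)$ and $w_i^{(0)}=1$ for all $i$. In round $r=1,\dots,t$: draw a sample $S^{(r)}$ of size $\big\lceil \frac{C_1}{\alpha'\epsilon'}\big(d\ln\frac1{\epsilon'}+\ln\frac1{\delta'}\big)\big\rceil$ from the mixture $\frac{1}{\Phi^{(r-1)}}\sum_i w_i^{(r-1)}D_i$,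 where $\Phi^{(r-1)}=\sum_i w_i^{(r-1)}$; let $f^{(r)}=\mathcal O_{\mathcal F}(S^{(r)})$; for each player $i$ draw a test sample $T_i$ of size $\big\lceil\frac{C_2}{\alpha'\epsilon'}\ln\frac1{\alpha'}\big\rceil$ from $D_i$, and set $w_i^{(r)}=w_i^{(r-1)}(1+s_i^{(r)})$ with $$s_i^{(r)}=\min\Big(\frac{\mathrm{err}_{T_i}(f^{(r)})\,\alpha'^2}{(1+3\alpha')\,\mathrm{err}_{S^{(r)}}(f^{(r)})+3\epsilon'},\ \alpha'\Big).$$ All draws of a round are independent given the past. The output $f_{\mathrm{NR2}}$ is the majority vote of $f^{(1)},\dots,f^{(t)}$ (ties are resolved to the label $0$). Here $\mathcal O_{\mathcal F}$ is any (measurable) empirical risk minimization oracle with slack $\epsilon'$: $\mathcal O_{\mathcal F}(S)\in\mathcal F$ and $\mathrm{err}_S(\mathcal O_{\mathcal F}(S))\le\inf_{f\in\mathcal F}\mathrm{err}_S(f)+\epsilon'$ for every sample $S$. Theorem. There are universal constants $C_1,C_2,C>0$ such that for all $k\ge1$, $d\ge 0$, all $\epsilon,\delta\in(0,1)$ and all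 $\alpha$ with $5\epsilon/4<\alpha<1$, the following holds. (1) For all $\mathcal X,\mathcal F,D_1,\dots,D_k,\mathcal O_{\mathcal F}$ as above, with probability at least $1-\delta$ over the samples, $\mathrm{err}_{D_i}(f_{\mathrm{NR2}})\le(2+\alpha)\,\mathrm{OPT}+\epsilon$ for all $i\in\{1,\dots,k\}$ simultaneously. (2) The total number $m$ of samples drawn by the algorithm satisfies $$m\le \frac{C}{\alpha^4\epsilon}\ln\Big(\frac{2k}{\delta}\Big)\Big(d\ln\frac1\epsilon+k\ln\frac2\alpha+\ln\frac1\delta\Big),$$ and if $\alpha\le 1/2$ and $2\delta\le k$ (the latter is automatic for $k\ge2$), then also $$m\le \frac{C}{\alpha^4\epsilon}\ln\Big(\frac{k}{\delta}\Big)\Big(d\ln\frac1\epsilon+k\ln\frac1\alpha+\ln\frac1\delta\Big).$$ -/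

import Mathlib

open MeasureTheory

noncomputable section

namespace CollabPAC

/-- A finite set `A` of instances is shattered by the class `F`: every labelling of `A` is
realized by a hypothesis of `F`. -/
def Shatters {X : Type*} (F : Set (X → Bool)) (A : Finset X) : Prop :=
  ∀ g : X → Bool, ∃ f ∈ F, ∀ x ∈ A, f x = g x

/-- The VC dimension of a class of hypotheses: the supremum of the sizes of its shattered sets. -/
def vcDim {X : Type*} (F : Set (X → Bool)) : ℕ∞ :=
  ⨆ A : {A : Finset X // Shatters F A}, (A.1.card : ℕ∞)

/-- The error `Pr_{(x,y) ∼ D} [f x ≠ y]` of a classifier on a distribution. -/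
def err {X : Type*} [MeasurableSpace X] (D : Measure (X × Bool)) (f : X → Bool) : ℝ :=
  D.real {p | f p.1 ≠ p.2}

/-- The empirical error of a classifier on a sample of size `n`: the fraction of mistakes. -/
def empErr {X : Type*} {n : ℕ} (S : Fin n → X × Bool) (f : X → Bool) : ℝ :=
  ((Finset.univ.filter fun j => f (S j).1 ≠ (S j).2).card : ℝ) / n

/-- `OPT = inf_{f ∈ F} max_i err_{D_i}(f)`. -/
def OPT {X : Type*} [MeasurableSpace X] {k : ℕ} (F : Set (X → Bool))
    (D : Fin k → Measure (X × Bool)) : ℝ :=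
  ⨅ f : F, ⨆ i, err (D i) f.1

/-- `O` is an empirical error minimization oracle for `F` with slack `τ`: on every sample it
returns a member of `F` whose empirical error is within `τ` of the infimum over `F`.
As always for a learning algorithm that is fed random samples, the label that the returned
hypothesis gives to `x` depends measurably on the sample and `x`. -/
structure IsOracle {X : Type*} [MeasurableSpace X] (F : Set (X → Bool)) (τ : ℝ)
    (O : (n : ℕ) → (Fin n → X × Bool) → X → Bool) : Prop where
  mem : ∀ n S, O n S ∈ F
  empErr_le : ∀ n S, empErr S (O n S) ≤ (⨅ f : F, empErr S f.1) + τ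
  measurable : ∀ n, Measurable fun p : (Fin n → X × Bool) × X => O n p.1 p.2

/-- The majority vote of `t` classifiers (ties give the label `false`). -/
def maj {X : Type*} {t : ℕ} (f : Fin t → X → Bool) (x : X) : Bool :=
  decide (t < 2 * (Finset.univ.filter fun r => f r x = true).card)

/-- The samples drawn in one round: a sample `S` of size `m` from the mixture, and for each of
the `k` players a test sample `T i` of size `n`. -/
abbrev Round (X : Type*) (k m n : ℕ) : Type _ :=
  (Fin m → X × Bool) × (Fin k → Fin n → X × Bool)

section Algorithm

variable {X : Type*} {k m n : ℕ}

/-- The classifier that is learned in a round. -/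
def roundClassifier (O : (n : ℕ) → (Fin n → X × Bool) → X → Bool) (R : Round X k m n) :
    X → Bool :=
  O m R.1

/-- The increment `s_i` of a round, for the parameters `a = α'` and `e = ε'`. -/
def increment (O : (n : ℕ) → (Fin n → X × Bool) → X → Bool) (a e : ℝ) (R : Round X k m n)
    (i : Fin k) : ℝ :=
  min (empErr (R.2 i) (roundClassifier O R) * a ^ 2 /
    ((1 + 3 * a) * empErr R.1 (roundClassifier O R) + 3 * e)) a

/-- The weight `w_i` after the rounds `h`: it starts at `1` and is multiplied by `1 + s_i` in each
round. -/
def weight (O : (n : ℕ) → (Fin n → X × Bool) → X → Bool) (a e : ℝ) {r : ℕ}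
    (h : Fin r → Round X k m n) (i : Fin k) : ℝ :=
  ∏ q, (1 + increment O a e (h q) i)

/-- The mixture `(1/Φ) ∑ i, w_i D_i`, where `Φ = ∑ i, w_i`. -/
def mixture [MeasurableSpace X] (D : Fin k → Measure (X × Bool)) (w : Fin k → ℝ) :
    Measure (X × Bool) :=
  ∑ i, ENNReal.ofReal (w i / ∑ j, w j) • D i

/-- The law of the samples of a round that starts with the weights `w`: all draws are independent,
those of the first sample from the mixture, those of the `i`-th test sample from `D i`. -/
def roundLaw [MeasurableSpace X] (m n : ℕ) (D : Fin k → Measure (X × Bool)) (w : Fin k → ℝ) :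
    Measure (Round X k m n) :=
  (Measure.pi fun _ : Fin m => mixture D w).prod
    (Measure.pi fun i : Fin k => Measure.pi fun _ : Fin n => D i)

/-- The law of all samples drawn during the first `r` rounds. -/
def runLaw [MeasurableSpace X] (O : (n : ℕ) → (Fin n → X × Bool) → X → Bool) (a e : ℝ)
    (m n : ℕ) (D : Fin k → Measure (X × Bool)) : (r : ℕ) → Measure (Fin r → Round X k m n)
  | 0 => Measure.dirac Fin.elim0
  | r + 1 => (runLaw O a e m n D r).bind fun h =>
      (roundLaw m n D (weight O a e h)).map fun R => (Fin.snoc h R : Fin (r + 1) → Round X k m n)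

end Algorithm

/-- The number of rounds `t = 2 ⌈ln (4k/δ) / α'³⌉`, `α' = α/40`. -/
def numRounds (k : ℕ) (α δ : ℝ) : ℕ :=
  2 * ⌈Real.log (4 * k / δ) / (α / 40) ^ 3⌉₊

/-- The size `C/(α'ε') (d ln (1/ε') + ln (1/δ'))` of the sample that is drawn from the mixture in
each round, `α' = α/40`, `ε' = ε/64`, `δ' = δ/(4t)`. -/
def trainSize (C : ℝ) (k d : ℕ) (ε δ α : ℝ) : ℕ :=
  ⌈C / ((α / 40) * (ε / 64)) *
    (d * Real.log (1 / (ε / 64)) + Real.log (1 / (δ / (4 * numRounds k α δ))))⌉₊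

/-- The size `C/(α'ε') ln (1/α')` of the test sample that is drawn from each player in each round,
`α' = α/40`, `ε' = ε/64`. -/
def testSize (C : ℝ) (ε α : ℝ) : ℕ :=
  ⌈C / ((α / 40) * (ε / 64)) * Real.log (1 / (α / 40))⌉₊

/-- The samples drawn in a complete run of Algorithm NR2 (with constants `C₁`, `C₂` in the sample
sizes) for `k` players. -/
abbrev NR2Run (X : Type*) (C₁ C₂ : ℝ) (k d : ℕ) (ε δ α : ℝ) : Type _ :=
  Fin (numRounds k α δ) → Round X k (trainSize C₁ k d ε δ α) (testSize C₂ ε α)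

/-- The law of the samples drawn in a complete run of Algorithm NR2. -/
def nr2Law {X : Type*} [MeasurableSpace X] (C₁ C₂ : ℝ) (d : ℕ) (ε δ α : ℝ)
    (O : (n : ℕ) → (Fin n → X × Bool) → X → Bool) {k : ℕ} (D : Fin k → Measure (X × Bool)) :
    Measure (NR2Run X C₁ C₂ k d ε δ α) :=
  runLaw O (α / 40) (ε / 64) _ _ D _

/-- The classifier that Algorithm NR2 returns: the majority vote over the classifiers of all
rounds. -/
def nr2Output {X : Type*} {C₁ C₂ : ℝ} {k d : ℕ} {ε δ α : ℝ}
    (O : (n : ℕ) → (Fin n → X × Bool) → X → Bool) (h : NR2Run X C₁ C₂ k d ε δ α) : X → Bool :=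
  maj fun r => roundClassifier O (h r)

/-- The number of labelled examples drawn in a run of Algorithm NR2: in each of the rounds, one
sample from the mixture and one test sample from each of the `k` players. -/
def nr2SampleCount (C₁ C₂ : ℝ) (k d : ℕ) (ε δ α : ℝ) : ℕ :=
  numRounds k α δ * (trainSize C₁ k d ε δ α + k * testSize C₂ ε α)

end CollabPAC

end

/-! In the analysis of Algorithm NR2 write `a = α / 40` and `e = ε / 64`.

*Sampling.* A symmetrisation argument with random swaps and the Sauer–Shelah lemma gives a relative
deviation bound: with high probability the classifier of a round has true error on the mixture at
most about `(1 + 3a) err_S + 3e`, where `S` is its training sample, and `err_S` in turn is at most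
about `(1 + a) OPT + O(e)`. The denominator in the increments is therefore a safe surrogate for the
error on the mixture.

*Weights.* On runs with good training samples the expected total weight grows by a factor of at
most `1 + a²` per round. On the other hand the weight of player `i`, divided into the exponential of
the discounted sum of the expected increments of `i`, has expectation at most one. By Markov's
inequality both bounds hold up to a factor `Λ = 4k/δ` in a typical run, and `t ≥ 2 ln Λ / a³` rounds
make the factor negligible: no player gains more than about `a²` per round on average.

*Voting.* A point on which the majority vote errs is misclassified in at least half of the rounds.
The rounds in which the expected increment of player `i` reaches the cap `a` are few, and in the
others the increment is proportional to the error of the round, so a vote with error above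
`(2 + α) OPT + ε` for player `i` would contradict the bound on the gains. -/

noncomputable section

open ProbabilityTheory
open scoped ENNReal

namespace CollabPAC

section SauerShelah

variable {X : Type*} {F : Set (X → Bool)} {d : ℕ}

lemma Shatters.card_le {A : Finset X} (hA : Shatters F A) (hd : vcDim F ≤ d) : A.card ≤ d := by
  have h : (A.card : ℕ∞) ≤ vcDim F :=
    le_iSup (fun A : {A : Finset X // Shatters F A} => (A.1.card : ℕ∞)) ⟨A, hA⟩
  exact_mod_cast h.trans hd

open Classical in
/-- The trace of a class of hypotheses on a finite set `A` as a family of subsets of `A`, each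
hypothesis being identified with the set of points that it labels `true`. This is the form in which
Mathlib's Sauer–Shelah lemma applies. -/
def traceFamily (F : Set (X → Bool)) (A : Finset X) : Finset (Finset A) :=
  Finset.univ.filter fun T => ∃ f ∈ F, ∀ x : A, x ∈ T ↔ f x = true

lemma mem_traceFamily {A : Finset X} {T : Finset A} :
    T ∈ traceFamily F A ↔ ∃ f ∈ F, ∀ x : A, x ∈ T ↔ f x = true := by
  simp [traceFamily]

lemma shatters_map_of_shatters_traceFamily [DecidableEq X] {A : Finset X} {s : Finset A}
    (hs : (traceFamily F A).Shatters s) :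
    Shatters F (s.map (Function.Embedding.subtype _)) := by
  intro g
  obtain ⟨T, hT, hsT⟩ := hs (Finset.filter_subset (fun x : A => g x = true) s)
  obtain ⟨f, hf, hTf⟩ := mem_traceFamily.1 hT
  refine ⟨f, hf, fun x hx => ?_⟩
  obtain ⟨y, hy, rfl⟩ := Finset.mem_map.1 hx
  have hfg : y ∈ s ∩ T ↔ g y = true := by rw [hsT, Finset.mem_filter, and_iff_right hy]
  rw [Finset.mem_inter, and_iff_right hy, hTf] at hfg
  exact Bool.eq_iff_iff.2 hfg

lemma card_traceFamily_le (hd : vcDim F ≤ d) (A : Finset X) :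
    (traceFamily F A).card ≤ ∑ i ∈ Finset.Iic d, A.card.choose i := by
  classical
  have hvc : (traceFamily F A).vcDim ≤ d := by
    refine Finset.sup_le fun s hs => ?_
    rw [← Finset.card_map (Function.Embedding.subtype _)]
    exact (shatters_map_of_shatters_traceFamily (Finset.mem_shatterer.1 hs)).card_le hd
  calc (traceFamily F A).card ≤ (traceFamily F A).shatterer.card :=
        Finset.card_le_card_shatterer _
    _ ≤ ∑ i ∈ Finset.Iic (traceFamily F A).vcDim, (Fintype.card A).choose i :=
        Finset.card_shatterer_le_sum_vcDim
    _ ≤ ∑ i ∈ Finset.Iic d, A.card.choose i := by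
        rw [Fintype.card_coe]
        exact Finset.sum_le_sum_of_subset (Finset.Iic_subset_Iic.2 hvc)

lemma exists_finset_eqOn_of_vcDim_le (hd : vcDim F ≤ d) (A : Finset X) :
    ∃ G : Finset (X → Bool), G.card ≤ ∑ i ∈ Finset.Iic d, A.card.choose i ∧
      ∀ f ∈ F, ∃ g ∈ G, Set.EqOn f g A := by
  classical
  choose! rep _ h_rep using fun T (hT : T ∈ traceFamily F A) => mem_traceFamily.1 hT
  refine ⟨(traceFamily F A).image rep, Finset.card_image_le.trans (card_traceFamily_le hd A),
    fun f hf => ?_⟩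
  set T : Finset A := Finset.univ.filter fun x => f x = true with hT_def
  have hT : T ∈ traceFamily F A := mem_traceFamily.2 ⟨f, hf, by simp [hT_def]⟩
  refine ⟨rep T, Finset.mem_image_of_mem rep hT, fun x hx => Bool.eq_iff_iff.2 ?_⟩
  rw [← h_rep T hT ⟨x, hx⟩]
  simp [hT_def]

lemma sum_choose_le_exp (n d : ℕ) {x : ℝ} (hx : 0 < x) (hx1 : x ≤ 1) :
    ((∑ i ∈ Finset.Iic d, n.choose i : ℕ) : ℝ) ≤ Real.exp (d * Real.log (1 / x) + n * x) := by
  have h_trunc : ∑ i ∈ Finset.Iic d, x ^ i * (n.choose i : ℝ) ≤ (1 + x) ^ n := by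
    calc ∑ i ∈ Finset.Iic d, x ^ i * (n.choose i : ℝ)
        = ∑ i ∈ Finset.Iic d ∩ Finset.range (n + 1), x ^ i * (n.choose i : ℝ) := by
          refine (Finset.sum_subset Finset.inter_subset_left fun i hi hi' => ?_).symm
          have hni : n < i := by simpa [Finset.mem_Iic.1 hi] using hi'
          rw [Nat.choose_eq_zero_of_lt hni, Nat.cast_zero, mul_zero]
      _ ≤ ∑ i ∈ Finset.range (n + 1), x ^ i * (n.choose i : ℝ) :=
          Finset.sum_le_sum_of_subset_of_nonneg Finset.inter_subset_right
            fun i _ _ => by positivity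
      _ = (1 + x) ^ n := by simp [add_comm (1 : ℝ) x, add_pow]
  have h_pow : x ^ d * ∑ i ∈ Finset.Iic d, (n.choose i : ℝ) ≤ (1 + x) ^ n := by
    refine le_trans ?_ h_trunc
    rw [Finset.mul_sum]
    exact Finset.sum_le_sum fun i hi => mul_le_mul_of_nonneg_right
      (pow_le_pow_of_le_one hx.le hx1 (Finset.mem_Iic.1 hi)) (Nat.cast_nonneg _)
  have h_exp : (1 + x) ^ n ≤ Real.exp (n * x) := by
    rw [Real.exp_nat_mul]
    exact pow_le_pow_left₀ (by positivity) (by linarith [Real.add_one_le_exp x]) n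
  have h_log : Real.exp (d * Real.log (1 / x)) = (x ^ d)⁻¹ := by
    rw [← Real.log_pow, Real.exp_log (by positivity), one_div, inv_pow]
  push_cast
  rw [Real.exp_add, h_log, le_inv_mul_iff₀ (by positivity)]
  exact h_pow.trans h_exp

lemma exists_finset_forall_eq_of_vcDim_le (hd : vcDim F ≤ d) {ι : Type*} [Fintype ι] (p : ι → X)
    {x : ℝ} (hx : 0 < x) (hx1 : x ≤ 1) :
    ∃ G : Finset (X → Bool),
      (G.card : ℝ) ≤ Real.exp (d * Real.log (1 / x) + Fintype.card ι * x) ∧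
        ∀ f ∈ F, ∃ g ∈ G, ∀ i, f (p i) = g (p i) := by
  classical
  obtain ⟨G, hG_card, hG⟩ := exists_finset_eqOn_of_vcDim_le hd (Finset.univ.image p)
  refine ⟨G, ?_, fun f hf => ?_⟩
  · have h_mono : ∑ i ∈ Finset.Iic d, (Finset.univ.image p).card.choose i ≤
        ∑ i ∈ Finset.Iic d, (Fintype.card ι).choose i :=
      Finset.sum_le_sum fun i _ => Nat.choose_le_choose i Finset.card_image_le
    exact (Nat.cast_le.2 (hG_card.trans h_mono)).trans (sum_choose_le_exp _ d hx hx1)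
  · obtain ⟨g, hgG, hfg⟩ := hG f hf
    exact ⟨g, hgG, fun i => hfg (by simp)⟩

end SauerShelah

section RandomSwaps

variable {Z ι : Type*} [Fintype ι]

/-- The Rademacher sign of a swap: `-1` if the swap is performed and `1` otherwise. -/
def swapSign (s : Bool) : ℝ := if s then -1 else 1

/-- The pair `z`, with its components exchanged if `s` holds. -/
def swapIf (s : Bool) (z : Z × Z) : Z × Z := if s then z.swap else z

/-- The double sample that arises from the pairs `z` when those with `σ j = true` are swapped. -/
def swapSample (σ : ι → Bool) (z : ι → Z × Z) : (ι → Z) × (ι → Z) :=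
  (fun j => (swapIf (σ j) (z j)).1, fun j => (swapIf (σ j) (z j)).2)

lemma sum_exp_sum_swapSign_le [DecidableEq ι] (c : ι → ℝ) :
    ∑ σ : ι → Bool, Real.exp (∑ j, swapSign (σ j) * c j) ≤
      2 ^ Fintype.card ι * Real.exp ((∑ j, c j ^ 2) / 2) := by
  have h_cosh (j : ι) : ∑ b : Bool, Real.exp (swapSign b * c j) ≤ 2 * Real.exp (c j ^ 2 / 2) := by
    have h := Real.cosh_le_exp_half_sq (c j)
    rw [Real.cosh_eq] at h
    simp only [Fintype.sum_bool, swapSign, if_true, Bool.false_eq_true, if_false, one_mul,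
      neg_one_mul]
    linarith
  calc ∑ σ : ι → Bool, Real.exp (∑ j, swapSign (σ j) * c j)
      = ∏ j, ∑ b : Bool, Real.exp (swapSign b * c j) := by
        simp only [Real.exp_sum, Finset.prod_univ_sum, Fintype.piFinset_univ]
    _ ≤ ∏ j, 2 * Real.exp (c j ^ 2 / 2) :=
        Finset.prod_le_prod (fun j _ => by positivity) fun j _ => h_cosh j
    _ = 2 ^ Fintype.card ι * Real.exp ((∑ j, c j ^ 2) / 2) := by
        rw [Finset.prod_mul_distrib, ← Real.exp_sum, Finset.sum_div, Finset.prod_const,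
          Finset.card_univ]

lemma card_le_sum_swapSign_le [DecidableEq ι] (c : ι → ℝ) {a : ℝ} (ha : 0 ≤ a) (u : ℝ) :
    ((Finset.univ.filter fun σ : ι → Bool => u ≤ ∑ j, swapSign (σ j) * c j).card : ℝ) ≤
      2 ^ Fintype.card ι * Real.exp (a ^ 2 / 2 * ∑ j, c j ^ 2 - a * u) := by
  rw [Real.exp_sub, ← mul_div_assoc, le_div_iff₀ (Real.exp_pos _), ← nsmul_eq_mul]
  calc _ ≤ ∑ σ ∈ Finset.univ.filter fun σ : ι → Bool => u ≤ ∑ j, swapSign (σ j) * c j,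
          Real.exp (∑ j, swapSign (σ j) * (a * c j)) := by
        refine Finset.card_nsmul_le_sum _ _ _ fun σ hσ => Real.exp_le_exp.2 ?_
        simp only [mul_left_comm _ a, ← Finset.mul_sum]
        exact mul_le_mul_of_nonneg_left (Finset.mem_filter.1 hσ).2 ha
    _ ≤ ∑ σ : ι → Bool, Real.exp (∑ j, swapSign (σ j) * (a * c j)) :=
        Finset.sum_le_univ_sum_of_nonneg fun σ => (Real.exp_pos _).le
    _ ≤ 2 ^ Fintype.card ι * Real.exp ((∑ j, (a * c j) ^ 2) / 2) :=
        sum_exp_sum_swapSign_le _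
    _ = 2 ^ Fintype.card ι * Real.exp (a ^ 2 / 2 * ∑ j, c j ^ 2) := by
        simp only [mul_pow, ← Finset.mul_sum, mul_div_right_comm]

lemma sum_swapSample_add (g : Z → ℝ) (σ : ι → Bool) (z : ι → Z × Z) :
    ∑ j, g ((swapSample σ z).1 j) + ∑ j, g ((swapSample σ z).2 j) =
      ∑ j, (g (z j).1 + g (z j).2) := by
  rw [← Finset.sum_add_distrib]
  refine Finset.sum_congr rfl fun j _ => ?_
  cases hj : σ j <;> simp [swapSample, swapIf, hj, add_comm]

lemma sum_swapSample_sub (g : Z → ℝ) (σ : ι → Bool) (z : ι → Z × Z) :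
    ∑ j, g ((swapSample σ z).2 j) - ∑ j, g ((swapSample σ z).1 j) =
      ∑ j, swapSign (σ j) * (g (z j).2 - g (z j).1) := by
  rw [← Finset.sum_sub_distrib]
  refine Finset.sum_congr rfl fun j _ => ?_
  cases hj : σ j <;> simp [swapSample, swapIf, swapSign, hj]

lemma ncard_swapSample_le {g : Z → ℝ} (hg : ∀ x, g x ∈ Set.Icc 0 1) (z : ι → Z × Z)
    {a u : ℝ} (ha : 0 ≤ a) (ha1 : a ≤ 1) (hu : 0 ≤ u) :
    ({σ : ι → Bool | (1 + 2 * a) * ∑ j, g ((swapSample σ z).1 j) + 2 * u ≤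
      ∑ j, g ((swapSample σ z).2 j)}.ncard : ℝ) ≤ 2 ^ Fintype.card ι * Real.exp (-(a * u)) := by
  classical
  set N := ∑ j, (g (z j).1 + g (z j).2) with hN
  set c : ι → ℝ := fun j => g (z j).2 - g (z j).1
  -- A `[0, 1]`-valued function has `(g y - g x) ^ 2 ≤ g x + g y`, so that the variance of the
  -- Rademacher sum is at most `N`; this makes the deviation bound relative.
  have h_var : ∑ j, c j ^ 2 ≤ N := by
    refine Finset.sum_le_sum fun j _ => ?_
    obtain ⟨h₀, h₁⟩ := hg (z j).1
    obtain ⟨h₀', h₁'⟩ := hg (z j).2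
    simp only [c]
    nlinarith [mul_nonneg h₀ h₀']
  have h_sub : {σ : ι → Bool | (1 + 2 * a) * ∑ j, g ((swapSample σ z).1 j) + 2 * u ≤
      ∑ j, g ((swapSample σ z).2 j)} ⊆
      Finset.univ.filter fun σ : ι → Bool => a / 2 * N + u ≤ ∑ j, swapSign (σ j) * c j := by
    intro σ hσ
    have hσ : (1 + 2 * a) * ∑ j, g ((swapSample σ z).1 j) + 2 * u ≤
      ∑ j, g ((swapSample σ z).2 j) := hσ
    have h₁ : 0 ≤ ∑ j, g ((swapSample σ z).1 j) := Finset.sum_nonneg fun j _ => (hg _).1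
    rw [Finset.coe_filter_univ, Set.mem_ofPred_eq, ← sum_swapSample_sub g, hN,
      ← sum_swapSample_add g σ]
    nlinarith [mul_nonneg ha h₁, mul_nonneg (mul_nonneg ha (sub_nonneg.2 ha1)) h₁,
      mul_le_mul_of_nonneg_left hσ (by linarith : 0 ≤ 1 - a / 2), mul_nonneg ha hu]
  calc _ ≤ ((Finset.univ.filter fun σ : ι → Bool =>
          a / 2 * N + u ≤ ∑ j, swapSign (σ j) * c j).card : ℝ) := by
        rw [← Set.ncard_coe_finset]
        exact_mod_cast Set.ncard_le_ncard h_sub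
    _ ≤ 2 ^ Fintype.card ι * Real.exp (a ^ 2 / 2 * ∑ j, c j ^ 2 - a * (a / 2 * N + u)) :=
        card_le_sum_swapSign_le c ha _
    _ ≤ 2 ^ Fintype.card ι * Real.exp (-(a * u)) := by
        gcongr
        nlinarith [mul_le_mul_of_nonneg_left h_var (sq_nonneg a)]

variable [MeasurableSpace Z]

lemma measurePreserving_swapIf (D : Measure Z) [SFinite D] (s : Bool) :
    MeasurePreserving (swapIf s) (D.prod D) (D.prod D) := by
  cases s
  · exact MeasurePreserving.id _
  · exact Measure.measurePreserving_swap

lemma measurePreserving_swapSample (D : ι → Measure Z) [∀ j, SigmaFinite (D j)] (σ : ι → Bool) :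
    MeasurePreserving (swapSample σ) (Measure.pi fun j => (D j).prod (D j))
      ((Measure.pi D).prod (Measure.pi D)) :=
  (measurePreserving_arrowProdEquivProdArrow Z Z ι D D).comp
    (measurePreserving_pi _ _ fun j => measurePreserving_swapIf (D j) (σ j))

lemma prod_pi_le_of_ncard_swapSample_le (D : ι → Measure Z) [∀ j, IsProbabilityMeasure (D j)]
    {A : Set ((ι → Z) × (ι → Z))} (hA : MeasurableSet A) {c : ℝ}
    (hc : ∀ z : ι → Z × Z,
      ({σ : ι → Bool | swapSample σ z ∈ A}.ncard : ℝ) ≤ 2 ^ Fintype.card ι * c) :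
    ((Measure.pi D).prod (Measure.pi D)) A ≤ ENNReal.ofReal c := by
  classical
  set ν := Measure.pi fun j => (D j).prod (D j)
  have h_swap (σ : ι → Bool) :
      ((Measure.pi D).prod (Measure.pi D)) A = ∫⁻ z, (swapSample σ ⁻¹' A).indicator 1 z ∂ν := by
    have hσ := measurePreserving_swapSample D σ
    rw [lintegral_indicator_one (hσ.measurable hA), hσ.measure_preimage hA.nullMeasurableSet]
  have h_count (z : ι → Z × Z) : ∑ σ : ι → Bool, (swapSample σ ⁻¹' A).indicator 1 z =
      ENNReal.ofReal ({σ : ι → Bool | swapSample σ z ∈ A}.ncard : ℝ) := by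
    simp [Set.indicator_apply, Set.ncard_eq_toFinset_card']
  have h_avg : ∑ _σ : ι → Bool, ((Measure.pi D).prod (Measure.pi D)) A ≤
      ENNReal.ofReal (2 ^ Fintype.card ι * c) := by
    rw [Finset.sum_congr rfl fun σ _ => h_swap σ, ← lintegral_finsetSum _ fun σ _ =>
      measurable_one.indicator ((measurePreserving_swapSample D σ).measurable hA)]
    calc _ ≤ ∫⁻ _z, ENNReal.ofReal (2 ^ Fintype.card ι * c) ∂ν :=
          lintegral_mono fun z => (h_count z).trans_le (ENNReal.ofReal_le_ofReal (hc z))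
      _ = ENNReal.ofReal (2 ^ Fintype.card ι * c) := by simp
  rw [ENNReal.ofReal_mul (by positivity), ENNReal.ofReal_pow zero_le_two, ENNReal.ofReal_ofNat,
    Finset.sum_const, Finset.card_univ, Fintype.card_fun, Fintype.card_bool, nsmul_eq_mul,
    Nat.cast_pow, Nat.cast_ofNat] at h_avg
  exact (ENNReal.mul_le_mul_iff_right (by simp) (by simp)).1 h_avg

end RandomSwaps

section BoundedRandomVariables

variable {Ω : Type*} [MeasurableSpace Ω] {μ : Measure Ω} [IsProbabilityMeasure μ]

lemma mgf_le_exp_of_mem_Icc {X : Ω → ℝ} (hXm : AEMeasurable X μ)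
    (hX : ∀ᵐ ω ∂μ, X ω ∈ Set.Icc 0 1) {a : ℝ} (ha : 0 ≤ a) (ha1 : a ≤ 1) :
    mgf X μ a ≤ Real.exp ((a + a ^ 2) * μ[X]) := by
  have hXi : Integrable X μ := .of_mem_Icc 0 1 hXm hX
  calc mgf X μ a ≤ ∫ ω, (1 + (a + a ^ 2) * X ω) ∂μ := by
        refine integral_mono_of_nonneg (.of_forall fun ω => (Real.exp_pos _).le)
          ((integrable_const _).add (hXi.const_mul _)) (hX.mono fun ω ⟨h₀, h₁⟩ => ?_)
        have haX : |a * X ω| ≤ 1 := by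
          rw [abs_of_nonneg (by positivity)]
          exact mul_le_one₀ ha1 h₀ h₁
        have h_exp := (abs_le.1 (Real.abs_exp_sub_one_sub_id_le haX)).2
        have h_sq : (a * X ω) ^ 2 ≤ a ^ 2 * X ω := by
          rw [mul_pow]
          exact mul_le_mul_of_nonneg_left (by nlinarith) (sq_nonneg a)
        dsimp only
        linarith
    _ = 1 + (a + a ^ 2) * μ[X] := by
        rw [integral_add (integrable_const _) (hXi.const_mul _), integral_const_mul]
        simp
    _ ≤ Real.exp ((a + a ^ 2) * μ[X]) := by linarith [Real.add_one_le_exp ((a + a ^ 2) * μ[X])]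

lemma variance_le_integral_of_mem_Icc {X : Ω → ℝ} (hXm : AEMeasurable X μ)
    (hX : ∀ᵐ ω ∂μ, X ω ∈ Set.Icc 0 1) : Var[X; μ] ≤ μ[X] := by
  have h := variance_le_sub_mul_sub hX hXm
  nlinarith [sq_nonneg μ[X]]

-- For `μ[X] = 0` the left-hand side is `0`, since `x / 0 = 0`.
lemma min_sub_mul_integral_abs_le_integral_min {X : Ω → ℝ} (hXi : Integrable X μ)
    (hX : 0 ≤ᵐ[μ] X) {M : ℝ} (hM : 0 ≤ M) :
    min μ[X] M - min μ[X] M / μ[X] * ∫ ω, |X ω - μ[X]| ∂μ ≤ ∫ ω, min (X ω) M ∂μ := by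
  set p := μ[X]
  have hp : 0 ≤ p := integral_nonneg_of_ae hX
  set r := min p M / p
  have hr : 0 ≤ r := div_nonneg (le_min hp hM) hp
  have hr1 : r ≤ 1 := div_le_one_of_le₀ (min_le_left _ _) hp
  have hrp : r * p = min p M := by
    rcases hp.eq_or_lt with hp0 | hp0
    · rw [← hp0, mul_zero, min_eq_left hM]
    · exact div_mul_cancel₀ _ hp0.ne'
  have h_dev : Integrable (fun ω => |X ω - p|) μ := (hXi.sub (integrable_const p)).abs
  calc min p M - r * ∫ ω, |X ω - p| ∂μ = ∫ ω, (min p M - r * |X ω - p|) ∂μ := by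
        rw [integral_sub (integrable_const _) (h_dev.const_mul r), integral_const_mul]
        simp
    _ ≤ ∫ ω, min (X ω) M ∂μ := by
        refine integral_mono_ae ((integrable_const _).sub (h_dev.const_mul r))
          (hXi.inf (integrable_const M)) (hX.mono fun ω (hω : 0 ≤ X ω) => le_min ?_ ?_)
        · have h_abs := mul_le_mul_of_nonneg_left (neg_le_abs (X ω - p)) hr
          have h_rX := mul_le_of_le_one_left hω hr1
          linarith
        · linarith [min_le_right p M, mul_nonneg hr (abs_nonneg (X ω - p))]

lemma lintegral_exp_div_one_add_le_one {s : Ω → ℝ} {a b : ℝ} (hsm : AEMeasurable s μ)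
    (hs : ∀ᵐ ω ∂μ, s ω ∈ Set.Icc 0 a) (ha1 : a ≤ 1) (hb : b ≤ μ[s]) :
    ∫⁻ ω, ENNReal.ofReal (Real.exp ((1 - a) * b) / (1 + s ω)) ∂μ ≤ 1 := by
  have hsi : Integrable s μ := .of_mem_Icc 0 a hsm hs
  have h_inv : ∀ᵐ ω ∂μ, Real.exp ((1 - a) * b) / (1 + s ω) ≤
      Real.exp ((1 - a) * b) * (1 - (1 - a) * s ω) := by
    refine hs.mono fun ω ⟨h₀, h₁⟩ => ?_
    rw [div_eq_mul_inv]
    refine mul_le_mul_of_nonneg_left ?_ (Real.exp_pos _).le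
    rw [inv_le_iff_one_le_mul₀ (by linarith)]
    nlinarith [mul_nonneg h₀ (sub_nonneg.2 h₁), mul_nonneg h₀ (mul_nonneg h₀ (h₀.trans h₁))]
  have h_int : Integrable (fun ω => Real.exp ((1 - a) * b) * (1 - (1 - a) * s ω)) μ :=
    ((integrable_const _).sub (hsi.const_mul _)).const_mul _
  have h_nonneg : ∀ᵐ ω ∂μ, 0 ≤ Real.exp ((1 - a) * b) * (1 - (1 - a) * s ω) := by
    filter_upwards [hs, h_inv] with ω hω h
    exact (div_nonneg (Real.exp_pos _).le (by linarith [hω.1])).trans h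
  have h_mean : 1 - (1 - a) * μ[s] ≤ Real.exp (-((1 - a) * b)) := by
    have h := mul_le_mul_of_nonneg_left hb (sub_nonneg.2 ha1)
    linarith [Real.add_one_le_exp (-((1 - a) * b))]
  calc ∫⁻ ω, ENNReal.ofReal (Real.exp ((1 - a) * b) / (1 + s ω)) ∂μ
      ≤ ∫⁻ ω, ENNReal.ofReal (Real.exp ((1 - a) * b) * (1 - (1 - a) * s ω)) ∂μ :=
        lintegral_mono_ae (h_inv.mono fun ω h => ENNReal.ofReal_le_ofReal h)
    _ = ENNReal.ofReal (Real.exp ((1 - a) * b) * (1 - (1 - a) * μ[s])) := by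
        rw [← ofReal_integral_eq_lintegral_ofReal h_int h_nonneg, integral_const_mul,
          integral_sub (integrable_const _) (hsi.const_mul _), integral_const_mul]
        simp
    _ ≤ ENNReal.ofReal (Real.exp ((1 - a) * b) * Real.exp (-((1 - a) * b))) := by gcongr
    _ = 1 := by rw [← Real.exp_add, add_neg_cancel, Real.exp_zero, ENNReal.ofReal_one]

end BoundedRandomVariables

section SampleMean

variable {Z : Type*} {n : ℕ} {g : Z → ℝ}

/-- The mean of `g` over the sample `S`; for the indicator `g` of the mistakes of a classifier this
is its empirical error. The mean over the empty sample is `0`. -/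
def sampleMean (g : Z → ℝ) (S : Fin n → Z) : ℝ := (∑ j, g (S j)) / n

lemma sampleMean_mem_Icc (hg : ∀ z, g z ∈ Set.Icc 0 1) (S : Fin n → Z) :
    sampleMean g S ∈ Set.Icc 0 1 := by
  refine ⟨div_nonneg (Finset.sum_nonneg fun j _ => (hg (S j)).1) n.cast_nonneg,
    div_le_one_of_le₀ ?_ n.cast_nonneg⟩
  simpa using Finset.sum_le_card_nsmul Finset.univ (fun j => g (S j)) 1 fun j _ => (hg (S j)).2

variable [MeasurableSpace Z]

lemma measurable_sampleMean_comp {Ω : Type*} [MeasurableSpace Ω] {g : Ω → Z → ℝ}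
    (hg : Measurable (Function.uncurry g)) {t : Ω → Fin n → Z} (ht : Measurable t) :
    Measurable fun ω => sampleMean (g ω) (t ω) :=
  (Finset.measurable_sum _ fun j _ =>
    hg.comp (measurable_id.prodMk ((measurable_pi_apply j).comp ht))).div_const _

lemma measurable_sampleMean (hgm : Measurable g) :
    Measurable (sampleMean g : (Fin n → Z) → ℝ) :=
  measurable_sampleMean_comp (g := fun _ => g) (hgm.comp measurable_snd) measurable_id

variable {D : Measure Z} [IsProbabilityMeasure D]

lemma integral_sampleMean (hn : n ≠ 0) (hg : Integrable g D) :
    ∫ S, sampleMean g S ∂(Measure.pi fun _ : Fin n => D) = ∫ z, g z ∂D := by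
  have h_eval (j : Fin n) :
      ∫ S : Fin n → Z, g (S j) ∂(Measure.pi fun _ : Fin n => D) = ∫ z, g z ∂D :=
    integral_comp_eval (μ := fun _ : Fin n => D) hg.aestronglyMeasurable
  simp only [sampleMean]
  rw [integral_div, integral_finsetSum _ fun j _ =>
    integrable_comp_eval (μ := fun _ : Fin n => D) (i := j) hg]
  simp only [h_eval, Finset.sum_const, Finset.card_univ, Fintype.card_fin, nsmul_eq_mul]
  field_simp

lemma variance_sampleMean (hg : MemLp g 2 D) :
    Var[sampleMean g; Measure.pi fun _ : Fin n => D] = Var[g; D] / n := by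
  have h_sum : (sampleMean g : (Fin n → Z) → ℝ) =
      fun S => (n : ℝ)⁻¹ * (∑ j, fun S : Fin n → Z => g (S j)) S := by
    funext S
    rw [sampleMean, Finset.sum_apply, div_eq_inv_mul]
  rw [h_sum, variance_const_mul, variance_sum_pi (X := fun _ => g) fun _ => hg]
  simp only [Finset.sum_const, Finset.card_univ, Fintype.card_fin, nsmul_eq_mul]
  rcases eq_or_ne n 0 with rfl | hn
  · simp
  · field_simp

variable (hgm : Measurable g) (hg : ∀ z, g z ∈ Set.Icc 0 1)
include hgm hg

lemma integrable_of_mem_Icc : Integrable g D :=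
  .of_mem_Icc 0 1 hgm.aemeasurable (.of_forall hg)

lemma variance_sampleMean_le :
    Var[sampleMean g; Measure.pi fun _ : Fin n => D] ≤ (∫ z, g z ∂D) / n := by
  rw [variance_sampleMean (memLp_of_bounded (.of_forall hg) hgm.aestronglyMeasurable 2)]
  gcongr
  exact variance_le_integral_of_mem_Icc hgm.aemeasurable (.of_forall hg)

lemma pi_lt_sampleMean_le {a e : ℝ} (ha : 0 ≤ a) (ha1 : a ≤ 1) :
    (Measure.pi fun _ : Fin n => D) {S | (1 + a) * ∫ z, g z ∂D + e < sampleMean g S} ≤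
      ENNReal.ofReal (Real.exp (-(a * e * n))) := by
  set μ := Measure.pi fun _ : Fin n => D
  set p := ∫ z, g z ∂D
  set Y : (Fin n → Z) → ℝ := fun S => ∑ j, g (S j)
  have h_mgf : mgf Y μ a ≤ Real.exp (n * ((a + a ^ 2) * p)) := by
    calc mgf Y μ a = mgf g D a ^ n := by
          simp only [mgf, Y, Finset.mul_sum, Real.exp_sum]
          rw [integral_fintype_prod_eq_pow fun z => Real.exp (a * g z), Fintype.card_fin]
      _ ≤ Real.exp ((a + a ^ 2) * p) ^ n := pow_le_pow_left₀ mgf_nonneg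
          (mgf_le_exp_of_mem_Icc hgm.aemeasurable (.of_forall hg) ha ha1) n
      _ = Real.exp (n * ((a + a ^ 2) * p)) := (Real.exp_nat_mul _ _).symm
  have h_int : Integrable (fun S => Real.exp (a * Y S)) μ := by
    simp only [Y, Finset.mul_sum, Real.exp_sum]
    refine .of_mem_Icc 0 (Real.exp a ^ n) (Finset.measurable_prod _ fun j _ =>
      ((hgm.comp (measurable_pi_apply j)).const_mul a).exp).aemeasurable
      (.of_forall fun S => ⟨by positivity, ?_⟩)
    calc ∏ j, Real.exp (a * g (S j)) ≤ ∏ _j : Fin n, Real.exp a :=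
          Finset.prod_le_prod (fun _ _ => (Real.exp_pos _).le) fun j _ =>
            Real.exp_le_exp.2 (mul_le_of_le_one_right ha (hg (S j)).2)
      _ = Real.exp a ^ n := by simp
  have h_sub : {S : Fin n → Z | (1 + a) * p + e < sampleMean g S} ⊆
      {S | n * ((1 + a) * p + e) ≤ Y S} := by
    intro S (hS : (1 + a) * p + e < sampleMean g S)
    rcases Nat.eq_zero_or_pos n with rfl | hn
    · simp [Y]
    · rw [sampleMean, lt_div_iff₀ (by exact_mod_cast hn), mul_comm] at hS
      exact hS.le
  rw [← ofReal_measureReal]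
  refine ENNReal.ofReal_le_ofReal ?_
  calc μ.real {S | (1 + a) * p + e < sampleMean g S}
      ≤ μ.real {S | n * ((1 + a) * p + e) ≤ Y S} := measureReal_mono h_sub
    _ ≤ Real.exp (-a * (n * ((1 + a) * p + e))) * mgf Y μ a :=
        measure_ge_le_exp_mul_mgf _ ha h_int
    _ ≤ Real.exp (-a * (n * ((1 + a) * p + e))) * Real.exp (n * ((a + a ^ 2) * p)) := by gcongr
    _ = Real.exp (-(a * e * n)) := by rw [← Real.exp_add]; ring_nf

lemma half_le_pi_le_sampleMean {a e : ℝ} (ha : 0 < a) (he : 0 < e) (hn : 2 ≤ a * e * n) :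
    2⁻¹ ≤ (Measure.pi fun _ : Fin n => D)
      {S | (1 - a / 2) * ∫ z, g z ∂D - e / 2 ≤ sampleMean g S} := by
  set μ := Measure.pi fun _ : Fin n => D
  set p := ∫ z, g z ∂D
  have hn0 : n ≠ 0 := by rintro rfl; norm_num at hn
  have hp : 0 ≤ p := integral_nonneg fun z => (hg z).1
  set c := a / 2 * p + e / 2 with hc
  have hc0 : 0 < c := by positivity
  have hL : MemLp (sampleMean g) 2 μ := memLp_of_bounded
    (.of_forall (sampleMean_mem_Icc hg)) (measurable_sampleMean hgm).aestronglyMeasurable 2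
  have h_cheb := meas_ge_le_variance_div_sq hL hc0
  rw [integral_sampleMean hn0 (integrable_of_mem_Icc hgm hg)] at h_cheb
  have h_var : Var[sampleMean g; μ] / c ^ 2 ≤ 1 / 2 := by
    rw [div_le_iff₀ (by positivity)]
    refine (variance_sampleMean_le hgm hg).trans ?_
    rw [div_le_iff₀ (by positivity)]
    -- AM-GM: `a e p ≤ c ^ 2`, the variance being at most `p / n ≤ a e p / 2`
    have h_amgm : a * p * e ≤ c ^ 2 := by nlinarith [sq_nonneg (a / 2 * p - e / 2)]
    nlinarith [mul_le_mul_of_nonneg_right h_amgm n.cast_nonneg, mul_le_mul_of_nonneg_left hn hp]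
  have h_lt : μ {S | (1 - a / 2) * p - e / 2 ≤ sampleMean g S}ᶜ ≤ 2⁻¹ := by
    refine (measure_mono fun S hS => ?_).trans
      (h_cheb.trans ((ENNReal.ofReal_le_ofReal h_var).trans_eq ?_))
    · have hS : sampleMean g S < (1 - a / 2) * p - e / 2 := not_le.1 hS
      change c ≤ |sampleMean g S - p|
      exact le_abs.2 (.inr (by rw [hc]; linarith))
    · rw [one_div, ENNReal.ofReal_inv_of_pos two_pos, ENNReal.ofReal_ofNat]
  rw [prob_compl_eq_one_sub (measurableSet_le measurable_const (measurable_sampleMean hgm)),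
    tsub_le_iff_right, ← ENNReal.inv_two_add_inv_two] at h_lt
  exact (ENNReal.add_le_add_iff_left (by simp)).1 h_lt

lemma integral_abs_sampleMean_sub_le {a e : ℝ} (ha : 0 < a) (hn : 1 ≤ a * e * n) :
    ∫ S, |sampleMean g S - ∫ z, g z ∂D| ∂(Measure.pi fun _ : Fin n => D) ≤
      (a * ∫ z, g z ∂D + e) / 2 := by
  set μ := Measure.pi fun _ : Fin n => D
  set p := ∫ z, g z ∂D
  have hn0 : n ≠ 0 := by rintro rfl; norm_num at hn
  set c := a * n with hc
  have hc0 : 0 < c := by positivity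
  have hY : Measurable (sampleMean g : (Fin n → Z) → ℝ) := measurable_sampleMean hgm
  have hYp : MemLp (fun S : Fin n → Z => sampleMean g S - p) 2 μ :=
    (memLp_of_bounded (.of_forall (sampleMean_mem_Icc hg)) hY.aestronglyMeasurable 2).sub
      (memLp_const p)
  have h_var : ∫ S, (sampleMean g S - p) ^ 2 ∂μ ≤ p / n := by
    have h := variance_sampleMean_le (n := n) (D := D) hgm hg
    rwa [variance_eq_integral hY.aemeasurable,
      integral_sampleMean hn0 (integrable_of_mem_Icc hgm hg)] at h
  have h_amgm (x : ℝ) : |x| ≤ (c * x ^ 2 + 1 / c) / 2 := by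
    have h : 0 ≤ (c * |x| - 1) ^ 2 / c := by positivity
    have h' : (c * |x| - 1) ^ 2 / c = c * |x| ^ 2 + 1 / c - 2 * |x| := by field_simp; ring
    rw [sq_abs] at h'
    linarith
  calc ∫ S, |sampleMean g S - p| ∂μ
      ≤ ∫ S, (c * (sampleMean g S - p) ^ 2 + 1 / c) / 2 ∂μ :=
        integral_mono (hYp.integrable one_le_two).abs
          (((hYp.integrable_sq.const_mul c).add (integrable_const _)).div_const 2)
          fun S => h_amgm _
    _ = (c * ∫ S, (sampleMean g S - p) ^ 2 ∂μ + 1 / c) / 2 := by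
        rw [integral_div, integral_add (hYp.integrable_sq.const_mul c) (integrable_const _),
          integral_const_mul]
        simp
    _ ≤ (c * (p / n) + 1 / c) / 2 := by gcongr
    _ ≤ (a * p + e) / 2 := by
        have h_inv : 1 / c ≤ e := by rw [div_le_iff₀ hc0]; linarith
        have h_cp : c * (p / n) = a * p := by rw [hc]; field_simp
        linarith

lemma le_integral_min_sampleMean {a e M : ℝ} (ha : 0 < a) (he : 0 ≤ e) (hn : 1 ≤ a * e * n)
    (hM : 0 ≤ M) :
    (1 - a / 2) * min (∫ z, g z ∂D) M - e / 2 ≤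
      ∫ S, min (sampleMean g S) M ∂(Measure.pi fun _ : Fin n => D) := by
  set p := ∫ z, g z ∂D
  have hn0 : n ≠ 0 := by rintro rfl; norm_num at hn
  have hp : 0 ≤ p := integral_nonneg fun z => (hg z).1
  set r := min p M / p
  have hr : 0 ≤ r := div_nonneg (le_min hp hM) hp
  have hr1 : r ≤ 1 := div_le_one_of_le₀ (min_le_left _ _) hp
  have hrp : r * p ≤ min p M := by
    rcases hp.eq_or_lt with hp0 | hp0
    · rw [← hp0, mul_zero, min_eq_left hM]
    · exact (div_mul_cancel₀ _ hp0.ne').le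
  have h_min := min_sub_mul_integral_abs_le_integral_min
    (μ := Measure.pi fun _ : Fin n => D) (X := sampleMean g)
    (integrable_of_mem_Icc (measurable_sampleMean hgm) (sampleMean_mem_Icc hg))
    (.of_forall fun S => (sampleMean_mem_Icc hg S).1) hM
  rw [integral_sampleMean hn0 (integrable_of_mem_Icc hgm hg)] at h_min
  refine le_trans ?_ h_min
  have h_dev := mul_le_mul_of_nonneg_left
    (integral_abs_sampleMean_sub_le (n := n) (D := D) hgm hg ha hn) hr
  nlinarith [mul_le_mul_of_nonneg_left hrp ha.le, mul_le_of_le_one_left he hr1]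

end SampleMean

section GhostSample

variable {Z : Type*} [MeasurableSpace Z] {m : ℕ} {D : Measure Z} [IsProbabilityMeasure D]
  {g : (Fin m → Z) → Z → ℝ}

lemma half_mul_pi_lt_integral_le_prod_pi (hgm : Measurable (Function.uncurry g))
    (hg : ∀ S z, g S z ∈ Set.Icc 0 1) {a e : ℝ} (ha : 0 < a) (ha1 : a ≤ 1 / 3) (he : 0 < e)
    (hm : 2 ≤ a * e * m) :
    2⁻¹ * (Measure.pi fun _ : Fin m => D)
        {S | (1 + 3 * a) * sampleMean (g S) S + 3 * e < ∫ z, g S z ∂D} ≤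
      ((Measure.pi fun _ : Fin m => D).prod (Measure.pi fun _ : Fin m => D))
        {q | (1 + 2 * a) * sampleMean (g q.1) q.1 + 2 * e ≤ sampleMean (g q.1) q.2} := by
  set μ := Measure.pi fun _ : Fin m => D
  set B := {S | (1 + 3 * a) * sampleMean (g S) S + 3 * e < ∫ z, g S z ∂D}
  have hB : MeasurableSet B := measurableSet_lt
    (((measurable_sampleMean_comp hgm measurable_id).const_mul _).add_const _)
    hgm.stronglyMeasurable.integral_prod_right.measurable
  have hg_fst : Measurable
      (Function.uncurry fun q : (Fin m → Z) × (Fin m → Z) => g q.1) :=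
    hgm.comp (measurable_fst.fst.prodMk measurable_snd)
  rw [Measure.prod_apply (measurableSet_le
    (((measurable_sampleMean_comp hg_fst measurable_fst).const_mul _).add_const _)
    (measurable_sampleMean_comp hg_fst measurable_snd)), ← lintegral_indicator_const hB]
  refine lintegral_mono fun S => ?_
  by_cases hS : S ∈ B
  · rw [Set.indicator_of_mem hS]
    refine (half_le_pi_le_sampleMean (hgm.comp measurable_prodMk_left) (hg S) ha he hm).trans
      (measure_mono fun S' hS' => ?_)
    have hS : (1 + 3 * a) * sampleMean (g S) S + 3 * e < ∫ z, g S z ∂D := hS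
    refine le_trans ?_ (show (1 - a / 2) * ∫ z, g S z ∂D - e / 2 ≤ sampleMean (g S) S' from hS')
    have h_err := mul_le_mul_of_nonneg_left hS.le (by linarith : 0 ≤ 1 - a / 2)
    have h_slack : 0 ≤ a * (1 / 2 - 3 / 2 * a) * sampleMean (g S) S :=
      mul_nonneg (mul_nonneg ha.le (by linarith)) (sampleMean_mem_Icc (hg S) S).1
    nlinarith
  · rw [Set.indicator_of_notMem hS]
    exact zero_le

end GhostSample

/-- The indicator of a mistake of the classifier `f` on a labelled example; `empErr` and `err` are
its means over a sample and over a distribution. -/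
def mistake {X : Type*} (f : X → Bool) (z : X × Bool) : ℝ := if f z.1 ≠ z.2 then 1 else 0

section Mistake

variable {X : Type*}

lemma mistake_mem_Icc (f : X → Bool) (z : X × Bool) : mistake f z ∈ Set.Icc 0 1 := by
  unfold mistake
  split_ifs <;> simp

lemma empErr_eq_sampleMean {n : ℕ} (S : Fin n → X × Bool) (f : X → Bool) :
    empErr S f = sampleMean (mistake f) S := by
  simp [empErr, sampleMean, mistake, Finset.sum_ite]

lemma empErr_mem_Icc {n : ℕ} (S : Fin n → X × Bool) (f : X → Bool) :
    empErr S f ∈ Set.Icc 0 1 :=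
  empErr_eq_sampleMean S f ▸ sampleMean_mem_Icc (mistake_mem_Icc f) S

lemma empErr_nonneg {n : ℕ} (S : Fin n → X × Bool) (f : X → Bool) : 0 ≤ empErr S f :=
  (empErr_mem_Icc S f).1

variable [MeasurableSpace X] {f : X → Bool}

lemma err_nonneg (D : Measure (X × Bool)) (f : X → Bool) : 0 ≤ err D f := measureReal_nonneg

lemma measurableSet_mistake (hf : Measurable f) :
    MeasurableSet {p : X × Bool | f p.1 ≠ p.2} :=
  (measurableSet_eq_fun (hf.comp measurable_fst) measurable_snd).compl

lemma measurable_mistake (hf : Measurable f) : Measurable (mistake f) :=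
  Measurable.ite (measurableSet_mistake hf) measurable_const measurable_const

lemma integral_mistake (D : Measure (X × Bool)) (hf : Measurable f) :
    ∫ z, mistake f z ∂D = err D f := by
  have h_ind : mistake f = ({p : X × Bool | f p.1 ≠ p.2}).indicator 1 := by
    funext z
    simp [mistake, Set.indicator_apply]
  rw [h_ind, integral_indicator_one (measurableSet_mistake hf)]
  rfl

end Mistake

/-- The denominator in the definition of `increment`: a bound for the error of the classifier
learned from the sample `S`, in terms of its empirical error. -/
def errBound {X : Type*} {m : ℕ} (O : (n : ℕ) → (Fin n → X × Bool) → X → Bool) (a e : ℝ)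
    (S : Fin m → X × Bool) : ℝ :=
  (1 + 3 * a) * empErr S (O m S) + 3 * e

lemma errBound_pos {X : Type*} {m : ℕ} (O : (n : ℕ) → (Fin n → X × Bool) → X → Bool)
    {a e : ℝ} (ha : 0 ≤ a) (he : 0 < e) (S : Fin m → X × Bool) : 0 < errBound O a e S := by
  have := empErr_nonneg S (O m S)
  unfold errBound
  positivity

section Oracle

variable {X : Type*} [MeasurableSpace X] {F : Set (X → Bool)} {τ : ℝ}
  {O : (n : ℕ) → (Fin n → X × Bool) → X → Bool} {m n : ℕ} {Ω : Type*} [MeasurableSpace Ω]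
  {s : Ω → Fin m → X × Bool} {t : Ω → Fin n → X × Bool}

lemma IsOracle.measurable_apply (hO : IsOracle F τ O) (S : Fin m → X × Bool) :
    Measurable (O m S) :=
  (hO.measurable m).comp measurable_prodMk_left

lemma IsOracle.measurable_uncurry_mistake (hO : IsOracle F τ O) (hs : Measurable s) :
    Measurable (Function.uncurry fun ω => mistake (O m (s ω))) := by
  have h : Measurable fun q : Ω × (X × Bool) => O m (s q.1) q.2.1 :=
    (hO.measurable m).comp ((hs.comp measurable_fst).prodMk measurable_snd.fst)
  exact Measurable.ite (measurableSet_eq_fun h measurable_snd.snd).compl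
    measurable_const measurable_const

lemma IsOracle.measurable_err (hO : IsOracle F τ O) (D : Measure (X × Bool))
    [IsProbabilityMeasure D] (hs : Measurable s) : Measurable fun ω => err D (O m (s ω)) := by
  simp only [← integral_mistake D (hO.measurable_apply _)]
  exact (hO.measurable_uncurry_mistake hs).stronglyMeasurable.integral_prod_right.measurable

lemma IsOracle.measurable_empErr (hO : IsOracle F τ O) (hs : Measurable s) (ht : Measurable t) :
    Measurable fun ω => empErr (t ω) (O m (s ω)) := by
  simp only [empErr_eq_sampleMean]
  exact measurable_sampleMean_comp (hO.measurable_uncurry_mistake hs) ht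

lemma IsOracle.measurable_errBound (hO : IsOracle F τ O) (a e : ℝ) (hs : Measurable s) :
    Measurable fun ω => errBound O a e (s ω) :=
  ((hO.measurable_empErr hs hs).const_mul _).add_const _

end Oracle

section UniformDeviation

variable {X : Type*} {F : Set (X → Bool)} {d m : ℕ}

lemma empErr_swapSample_congr {f g : X → Bool} {z : Fin m → (X × Bool) × (X × Bool)}
    (h₁ : ∀ j, f (z j).1.1 = g (z j).1.1) (h₂ : ∀ j, f (z j).2.1 = g (z j).2.1)
    (σ : Fin m → Bool) :
    empErr (swapSample σ z).1 f = empErr (swapSample σ z).1 g ∧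
      empErr (swapSample σ z).2 f = empErr (swapSample σ z).2 g := by
  constructor <;> rw [empErr_eq_sampleMean, empErr_eq_sampleMean] <;>
    refine congrArg (· / (m : ℝ)) (Finset.sum_congr rfl fun j _ => ?_) <;>
    cases hj : σ j <;> simp [mistake, swapSample, swapIf, hj, h₁, h₂]

lemma ncard_empErr_swapSample_le (f : X → Bool) (z : Fin m → (X × Bool) × (X × Bool)) {a e : ℝ}
    (ha : 0 ≤ a) (ha1 : a ≤ 1) (he : 0 ≤ e) (hm : m ≠ 0) :
    ({σ : Fin m → Bool | (1 + 2 * a) * empErr (swapSample σ z).1 f + 2 * e ≤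
        empErr (swapSample σ z).2 f}.ncard : ℝ) ≤
      2 ^ m * Real.exp (-(a * e * m)) := by
  have hm0 : (0 : ℝ) < m := by positivity
  have h := ncard_swapSample_le (mistake_mem_Icc f) z ha ha1 (u := e * m) (by positivity)
  rw [Fintype.card_fin, ← mul_assoc a] at h
  refine le_trans (mod_cast Set.ncard_le_ncard fun σ hσ => ?_) h
  rw [Set.mem_ofPred_eq, empErr_eq_sampleMean, empErr_eq_sampleMean, sampleMean, sampleMean,
    le_div_iff₀ hm0, add_mul, mul_assoc, div_mul_cancel₀ _ hm0.ne', mul_assoc] at hσ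
  exact hσ

lemma ncard_exists_empErr_swapSample_le (hd : vcDim F ≤ d)
    (z : Fin m → (X × Bool) × (X × Bool)) {a e : ℝ} (ha : 0 < a) (ha1 : a ≤ 1) (he : 0 < e)
    (he1 : e ≤ 1) (hm : m ≠ 0) :
    ({σ : Fin m → Bool | ∃ f ∈ F, (1 + 2 * a) * empErr (swapSample σ z).1 f + 2 * e ≤
        empErr (swapSample σ z).2 f}.ncard : ℝ) ≤
      2 ^ m * Real.exp (d * Real.log (8 / (a * e)) - 3 / 4 * (a * e * m)) := by
  obtain ⟨G, hG_card, hG⟩ := exists_finset_forall_eq_of_vcDim_le hd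
    (Sum.elim (fun j => (z j).1.1) fun j => (z j).2.1) (x := a * e / 8) (by positivity)
    (by nlinarith)
  set bad : (X → Bool) → Set (Fin m → Bool) := fun g =>
    {σ | (1 + 2 * a) * empErr (swapSample σ z).1 g + 2 * e ≤ empErr (swapSample σ z).2 g}
  have h_sub : {σ : Fin m → Bool | ∃ f ∈ F, (1 + 2 * a) * empErr (swapSample σ z).1 f + 2 * e ≤
      empErr (swapSample σ z).2 f} ⊆ ⋃ g ∈ G, bad g := by
    rintro σ ⟨f, hf, hσ⟩
    obtain ⟨g, hgG, hfg⟩ := hG f hf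
    obtain ⟨h₁, h₂⟩ :=
      empErr_swapSample_congr (fun j => hfg (Sum.inl j)) (fun j => hfg (Sum.inr j)) σ
    exact Set.mem_biUnion hgG (show _ ≤ _ from h₁ ▸ h₂ ▸ hσ)
  calc (_ : ℝ) ≤ ((⋃ g ∈ G, bad g).ncard : ℝ) := mod_cast Set.ncard_le_ncard h_sub
    _ ≤ ∑ g ∈ G, ((bad g).ncard : ℝ) := mod_cast Finset.set_ncard_biUnion_le G bad
    _ ≤ ∑ _g ∈ G, 2 ^ m * Real.exp (-(a * e * m)) :=
        Finset.sum_le_sum fun g _ => ncard_empErr_swapSample_le g z ha.le ha1 he.le hm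
    _ = G.card * (2 ^ m * Real.exp (-(a * e * m))) := by simp
    _ ≤ Real.exp (d * Real.log (1 / (a * e / 8)) + Fintype.card (Fin m ⊕ Fin m) * (a * e / 8)) *
        (2 ^ m * Real.exp (-(a * e * m))) := by gcongr
    _ = _ := by
        rw [mul_left_comm, ← Real.exp_add, one_div_div]
        congr 2
        simp only [Fintype.card_sum, Fintype.card_fin]
        push_cast
        ring

variable [MeasurableSpace X] {O : (n : ℕ) → (Fin n → X × Bool) → X → Bool} {τ : ℝ}

lemma IsOracle.pi_lt_err_le (hO : IsOracle F τ O) (hd : vcDim F ≤ d) (D : Measure (X × Bool))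
    [IsProbabilityMeasure D] {a e : ℝ} (ha : 0 < a) (ha1 : a ≤ 1 / 3) (he : 0 < e) (he1 : e ≤ 1)
    (hm : 2 ≤ a * e * m) :
    (Measure.pi fun _ : Fin m => D)
        {S | errBound O a e S < err D (O m S)} ≤
      ENNReal.ofReal (2 * Real.exp (d * Real.log (8 / (a * e)) - 3 / 4 * (a * e * m))) := by
  set μ := Measure.pi fun _ : Fin m => D
  have hm0 : m ≠ 0 := by rintro rfl; norm_num at hm
  have h_ghost := half_mul_pi_lt_integral_le_prod_pi (D := D)
    (hO.measurable_uncurry_mistake measurable_id) (fun S => mistake_mem_Icc (O m S)) ha ha1 he hm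
  simp only [id_eq, ← empErr_eq_sampleMean, integral_mistake D (hO.measurable_apply _)] at h_ghost
  have h_swap := prod_pi_le_of_ncard_swapSample_le (fun _ : Fin m => D)
    (A := {q | (1 + 2 * a) * empErr q.1 (O m q.1) + 2 * e ≤ empErr q.2 (O m q.1)})
    (measurableSet_le
      (((hO.measurable_empErr measurable_fst measurable_fst).const_mul _).add_const _)
      (hO.measurable_empErr measurable_fst measurable_snd))
    (c := Real.exp (d * Real.log (8 / (a * e)) - 3 / 4 * (a * e * m)))
    fun z => by
      rw [Fintype.card_fin]
      exact le_trans (mod_cast Set.ncard_le_ncard fun σ hσ => ⟨_, hO.mem _ _, hσ⟩)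
        (ncard_exists_empErr_swapSample_le hd z ha (by linarith) he he1 hm0)
  calc μ {S | errBound O a e S < err D (O m S)}
      = 2 * (2⁻¹ * μ {S | errBound O a e S < err D (O m S)}) := by
        rw [← mul_assoc, ENNReal.mul_inv_cancel (by simp) (by simp), one_mul]
    _ ≤ 2 * ENNReal.ofReal (Real.exp (d * Real.log (8 / (a * e)) - 3 / 4 * (a * e * m))) := by
        gcongr
        exact h_ghost.trans h_swap
    _ = _ := by rw [ENNReal.ofReal_mul two_pos.le, ENNReal.ofReal_ofNat]

/-- The training sample `S` is good: the error of the learned classifier on `D` is controlled by its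
empirical error, which in turn is controlled by `P`, a bound for the error of some hypothesis. -/
def TrainGood (O : (n : ℕ) → (Fin n → X × Bool) → X → Bool) (a e P : ℝ) (D : Measure (X × Bool))
    (S : Fin m → X × Bool) : Prop :=
  err D (O m S) ≤ errBound O a e S ∧
    empErr S (O m S) ≤ (1 + a) * P + 4 * e

lemma IsOracle.pi_not_trainGood_le {e : ℝ} (hO : IsOracle F e O) (hd : vcDim F ≤ d)
    (D : Measure (X × Bool)) [IsProbabilityMeasure D] {a : ℝ} (ha : 0 < a) (ha1 : a ≤ 1 / 3)
    (he : 0 < e) (he1 : e ≤ 1) (hm : 2 ≤ a * e * m) {P : ℝ} {f : X → Bool} (hfF : f ∈ F)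
    (hf : Measurable f) (hfP : err D f ≤ P + e) :
    (Measure.pi fun _ : Fin m => D) {S | ¬ TrainGood O a e P D S} ≤
      ENNReal.ofReal (2 * Real.exp (d * Real.log (8 / (a * e)) - 3 / 4 * (a * e * m)) +
        Real.exp (-(a * e * m))) := by
  have h_comparison := pi_lt_sampleMean_le (n := m) (D := D) (measurable_mistake hf)
    (mistake_mem_Icc f) (e := e) ha.le (by linarith)
  simp only [← empErr_eq_sampleMean, integral_mistake D hf] at h_comparison
  rw [ENNReal.ofReal_add (by positivity) (by positivity)]
  refine (measure_mono ?_).trans ((measure_union_le _ _).trans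
    (add_le_add (hO.pi_lt_err_le hd D ha ha1 he he1 hm) h_comparison))
  intro S hS
  by_contra h_good
  simp only [Set.mem_union, Set.mem_ofPred_eq, not_or, not_lt] at h_good
  refine hS ⟨h_good.1, ?_⟩
  have h_inf : (⨅ f : F, empErr S f.1) ≤ empErr S f :=
    ciInf_le (f := fun f : F => empErr S f.1)
      ⟨0, by rintro _ ⟨g, rfl⟩; exact empErr_nonneg S g.1⟩ ⟨f, hfF⟩
  have h_erm := hO.empErr_le m S
  have h_P := mul_le_mul_of_nonneg_left hfP (by linarith : 0 ≤ 1 + a)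
  nlinarith [h_good.2]

end UniformDeviation

section Gain

/-- A lower bound for the expected increment of a player on whose distribution the learned
classifier has error `q`, when the denominator in the definition of `increment` is `B`. -/
def gain (a e B q : ℝ) : ℝ := max 0 (a ^ 2 / B * ((1 - a / 2) * min q (B / a) - e / 2))

lemma gain_nonneg (a e B q : ℝ) : 0 ≤ gain a e B q := le_max_left _ _

lemma measurable_gain (a e : ℝ) : Measurable fun p : ℝ × ℝ => gain a e p.1 p.2 := by
  unfold gain
  fun_prop

variable {X : Type*} {n : ℕ} {f : X → Bool} {a e B : ℝ}

/-- The increment of a player with the test sample `T`, when the learned classifier is `f` and the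
denominator in the definition of `increment` is `B`. -/
def testIncrement (a B : ℝ) (f : X → Bool) (T : Fin n → X × Bool) : ℝ :=
  min (empErr T f * a ^ 2 / B) a

lemma testIncrement_mem_Icc (ha : 0 ≤ a) (hB : 0 ≤ B) (T : Fin n → X × Bool) :
    testIncrement a B f T ∈ Set.Icc 0 a := by
  have := empErr_nonneg T f
  exact ⟨le_min (by positivity) ha, min_le_right _ _⟩

variable [MeasurableSpace X]

lemma measurable_empErr (hf : Measurable f) :
    Measurable fun T : Fin n → X × Bool => empErr T f := by
  simp only [empErr_eq_sampleMean]
  exact measurable_sampleMean (measurable_mistake hf)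

lemma measurable_testIncrement (hf : Measurable f) :
    Measurable (testIncrement a B f : (Fin n → X × Bool) → ℝ) :=
  (((measurable_empErr hf).mul_const _).div_const _).min measurable_const

variable (D : Measure (X × Bool)) [IsProbabilityMeasure D]

lemma integral_testIncrement_le (hn : n ≠ 0) (hf : Measurable f) (ha : 0 ≤ a)
    (hB : 0 ≤ B) :
    ∫ T, testIncrement a B f T ∂(Measure.pi fun _ : Fin n => D) ≤
      err D f * a ^ 2 / B := by
  have h_mean : ∫ T, empErr T f ∂(Measure.pi fun _ : Fin n => D) = err D f := by
    simp only [empErr_eq_sampleMean]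
    rw [integral_sampleMean hn
      (integrable_of_mem_Icc (measurable_mistake hf) (mistake_mem_Icc f)), integral_mistake D hf]
  rw [← h_mean, ← integral_mul_const, ← integral_div]
  exact integral_mono_of_nonneg (.of_forall fun T => (testIncrement_mem_Icc ha hB T).1)
    (((integrable_of_mem_Icc (measurable_empErr hf) fun T =>
      empErr_mem_Icc T f).mul_const _).div_const _) (.of_forall fun T => min_le_left _ _)

lemma gain_le_integral_testIncrement (hf : Measurable f) (ha : 0 < a) (he : 0 ≤ e)
    (hn : 1 ≤ a * e * n) (hB : 0 < B) :
    gain a e B (err D f) ≤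
      ∫ T, testIncrement a B f T ∂(Measure.pi fun _ : Fin n => D) := by
  refine max_le (integral_nonneg fun T => (testIncrement_mem_Icc ha.le hB.le T).1) ?_
  have h_min (x : ℝ) : min (x * a ^ 2 / B) a = a ^ 2 / B * min x (B / a) := by
    rw [mul_min_of_nonneg _ _ (by positivity)]
    congr 1 <;> field_simp
  have h_mean := le_integral_min_sampleMean (D := D) (measurable_mistake hf) (mistake_mem_Icc f)
    ha he hn (M := B / a) (by positivity)
  simp only [integral_mistake D hf, ← empErr_eq_sampleMean] at h_mean
  simp only [testIncrement, h_min, integral_const_mul]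
  exact mul_le_mul_of_nonneg_left h_mean (by positivity)

lemma lintegral_exp_gain_div_le_one (hf : Measurable f) (ha : 0 < a) (ha1 : a ≤ 1) (he : 0 ≤ e)
    (hn : 1 ≤ a * e * n) (hB : 0 < B) :
    ∫⁻ T, ENNReal.ofReal (Real.exp ((1 - a) * gain a e B (err D f)) /
      (1 + testIncrement a B f T)) ∂(Measure.pi fun _ : Fin n => D) ≤ 1 :=
  lintegral_exp_div_one_add_le_one (measurable_testIncrement hf).aemeasurable
    (.of_forall (testIncrement_mem_Icc ha.le hB.le)) ha1
    (gain_le_integral_testIncrement D hf ha he hn hB)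

lemma lintegral_mul_one_add_testIncrement_le (hn : n ≠ 0) (hf : Measurable f) (ha : 0 ≤ a)
    (hB : 0 ≤ B) {w : ℝ} (hw : 0 ≤ w) :
    ∫⁻ T, ENNReal.ofReal (w * (1 + testIncrement a B f T))
        ∂(Measure.pi fun _ : Fin n => D) ≤
      ENNReal.ofReal (w * (1 + err D f * a ^ 2 / B)) := by
  have h_mem := testIncrement_mem_Icc (n := n) (f := f) ha hB
  have h_int : Integrable (testIncrement a B f : (Fin n → X × Bool) → ℝ)
      (Measure.pi fun _ => D) :=
    .of_mem_Icc 0 a (measurable_testIncrement hf).aemeasurable (.of_forall h_mem)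
  have h_int' : Integrable (fun T => w * (1 + testIncrement a B f T))
      (Measure.pi fun _ : Fin n => D) := ((integrable_const 1).add h_int).const_mul w
  rw [← ofReal_integral_eq_lintegral_ofReal h_int'
      (.of_forall fun T => mul_nonneg hw (by linarith [(h_mem T).1])),
    integral_const_mul, integral_add (integrable_const _) h_int]
  simp only [integral_const, probReal_univ, one_smul]
  gcongr
  exact integral_testIncrement_le D hn hf ha hB

end Gain

section Mixture

variable {X : Type*} [MeasurableSpace X] {k : ℕ}

lemma measurable_mixture {Ω : Type*} [MeasurableSpace Ω] (D : Fin k → Measure (X × Bool))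
    {w : Ω → Fin k → ℝ} (hw : ∀ i, Measurable fun ω => w ω i) :
    Measurable fun ω => mixture D (w ω) := by
  refine Measure.measurable_of_measurable_coe _ fun s _ => ?_
  simp only [mixture, Measure.finsetSum_apply, Measure.smul_apply, smul_eq_mul]
  exact Finset.measurable_sum _ fun i _ =>
    (((hw i).div (Finset.measurable_sum _ fun j _ => hw j)).ennreal_ofReal).mul_const _

variable (D : Fin k → Measure (X × Bool)) [∀ i, IsProbabilityMeasure (D i)] {w : Fin k → ℝ}

lemma err_mixture (hw : ∀ i, 0 ≤ w i) (f : X → Bool) :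
    err (mixture D w) f = (∑ i, w i * err (D i) f) / ∑ j, w j := by
  unfold err mixture
  rw [measureReal_def, Measure.finsetSum_apply, ENNReal.toReal_sum, Finset.sum_div]
  · refine Finset.sum_congr rfl fun i _ => ?_
    rw [Measure.smul_apply, smul_eq_mul, ENNReal.toReal_mul, ENNReal.toReal_ofReal
      (div_nonneg (hw i) (Finset.sum_nonneg fun j _ => hw j)), div_mul_eq_mul_div]
    rfl
  · intro i _
    rw [Measure.smul_apply, smul_eq_mul]
    exact ENNReal.mul_ne_top ENNReal.ofReal_ne_top (measure_ne_top _ _)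

variable [NeZero k]

lemma isProbabilityMeasure_mixture (hw : ∀ i, 0 < w i) : IsProbabilityMeasure (mixture D w) := by
  have hW : 0 < ∑ j, w j := Finset.sum_pos (fun j _ => hw j) Finset.univ_nonempty
  constructor
  unfold mixture
  rw [Measure.finsetSum_apply]
  simp only [Measure.smul_apply, measure_univ, smul_eq_mul, mul_one]
  rw [← ENNReal.ofReal_sum_of_nonneg fun i _ => div_nonneg (hw i).le hW.le, ← Finset.sum_div,
    div_self hW.ne', ENNReal.ofReal_one]

lemma sum_mul_one_add_err_le (hw : ∀ i, 0 < w i) {f : X → Bool} {c B : ℝ} (hc : 0 ≤ c)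
    (hB : 0 < B) (hf : err (mixture D w) f ≤ B) :
    ∑ i, w i * (1 + err (D i) f * c / B) ≤ (1 + c) * ∑ i, w i := by
  have hW : 0 < ∑ j, w j := Finset.sum_pos (fun j _ => hw j) Finset.univ_nonempty
  rw [err_mixture D fun i => (hw i).le, div_le_iff₀ hW] at hf
  calc ∑ i, w i * (1 + err (D i) f * c / B)
      = ∑ i, w i + c / B * ∑ i, w i * err (D i) f := by
        rw [Finset.mul_sum, ← Finset.sum_add_distrib]
        exact Finset.sum_congr rfl fun i _ => by ring
    _ ≤ ∑ i, w i + c / B * (B * ∑ i, w i) := by gcongr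
    _ = (1 + c) * ∑ i, w i := by field_simp

lemma lintegral_sum_mul_one_add_testIncrement_le (hw : ∀ i, 0 < w i) {n : ℕ} (hn : n ≠ 0)
    {f : X → Bool} (hf : Measurable f) {a B : ℝ} (ha : 0 ≤ a) (hB : 0 < B)
    (h_err : err (mixture D w) f ≤ B) :
    ∫⁻ T, ENNReal.ofReal (∑ i, w i * (1 + testIncrement a B f (T i)))
        ∂(Measure.pi fun i => Measure.pi fun _ : Fin n => D i) ≤
      ENNReal.ofReal ((1 + a ^ 2) * ∑ i, w i) := by
  have h_meas (i : Fin k) : Measurable fun T : Fin n → X × Bool =>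
      ENNReal.ofReal (w i * (1 + testIncrement a B f T)) :=
    (((measurable_testIncrement hf).const_add 1).const_mul _).ennreal_ofReal
  have h_nonneg (i : Fin k) (T : Fin n → X × Bool) :
      0 ≤ w i * (1 + testIncrement a B f T) :=
    mul_nonneg (hw i).le (by linarith [(testIncrement_mem_Icc (f := f) ha hB.le T).1])
  have h_err_nonneg (i : Fin k) : 0 ≤ w i * (1 + err (D i) f * a ^ 2 / B) := by
    have := err_nonneg (D i) f
    have := (hw i).le
    positivity
  simp only [fun T : Fin k → Fin n → X × Bool =>
    ENNReal.ofReal_sum_of_nonneg fun i (_ : i ∈ Finset.univ) => h_nonneg i (T i)]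
  calc _ = ∑ i, ∫⁻ T : Fin k → Fin n → X × Bool,
          ENNReal.ofReal (w i * (1 + testIncrement a B f (T i)))
          ∂(Measure.pi fun i => Measure.pi fun _ : Fin n => D i) :=
        lintegral_finsetSum _ fun i _ => (h_meas i).comp (measurable_pi_apply i)
    _ = ∑ i, ∫⁻ T, ENNReal.ofReal (w i * (1 + testIncrement a B f T))
          ∂(Measure.pi fun _ : Fin n => D i) :=
        Finset.sum_congr rfl fun i _ => (measurePreserving_eval
          (fun i : Fin k => Measure.pi fun _ : Fin n => D i) i).lintegral_comp (h_meas i)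
    _ ≤ ∑ i, ENNReal.ofReal (w i * (1 + err (D i) f * a ^ 2 / B)) :=
        Finset.sum_le_sum fun i _ =>
          lintegral_mul_one_add_testIncrement_le (D i) hn hf ha hB.le (hw i).le
    _ = ENNReal.ofReal (∑ i, w i * (1 + err (D i) f * a ^ 2 / B)) :=
        (ENNReal.ofReal_sum_of_nonneg fun i _ => h_err_nonneg i).symm
    _ ≤ ENNReal.ofReal ((1 + a ^ 2) * ∑ i, w i) :=
        ENNReal.ofReal_le_ofReal (sum_mul_one_add_err_le D hw (sq_nonneg a) hB h_err)

end Mixture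

section Weights

variable {X : Type*} {F : Set (X → Bool)} {τ : ℝ}
  {O : (n : ℕ) → (Fin n → X × Bool) → X → Bool} {k m n r : ℕ} {a e : ℝ}

lemma increment_eq_testIncrement (O : (n : ℕ) → (Fin n → X × Bool) → X → Bool) (a e : ℝ)
    (R : Round X k m n) (i : Fin k) :
    increment O a e R i = testIncrement a (errBound O a e R.1) (O m R.1) (R.2 i) :=
  rfl

lemma increment_nonneg (O : (n : ℕ) → (Fin n → X × Bool) → X → Bool) (ha : 0 ≤ a) (he : 0 < e)
    (R : Round X k m n) (i : Fin k) : 0 ≤ increment O a e R i := by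
  rw [increment_eq_testIncrement]
  exact (testIncrement_mem_Icc ha (errBound_pos O ha he R.1).le (R.2 i)).1

lemma weight_pos (O : (n : ℕ) → (Fin n → X × Bool) → X → Bool) (ha : 0 ≤ a) (he : 0 < e)
    (h : Fin r → Round X k m n) (i : Fin k) : 0 < weight O a e h i :=
  Finset.prod_pos fun q _ => by linarith [increment_nonneg O ha he (h q) i]

lemma weight_snoc (O : (n : ℕ) → (Fin n → X × Bool) → X → Bool) (a e : ℝ)
    (h : Fin r → Round X k m n) (R : Round X k m n) (i : Fin k) :
    weight O a e (Fin.snoc h R : Fin (r + 1) → Round X k m n) i =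
      weight O a e h i * (1 + increment O a e R i) := by
  simp [weight, Fin.prod_univ_castSucc]

variable [MeasurableSpace X]

lemma IsOracle.measurable_testIncrement (hO : IsOracle F τ O) (a e : ℝ)
    {Ω : Type*} [MeasurableSpace Ω] {s : Ω → Fin m → X × Bool} {t : Ω → Fin n → X × Bool}
    (hs : Measurable s) (ht : Measurable t) : Measurable fun ω =>
      testIncrement a (errBound O a e (s ω)) (O m (s ω)) (t ω) :=
  (((hO.measurable_empErr hs ht).mul_const _).div (hO.measurable_errBound a e hs)).min
    measurable_const

lemma IsOracle.measurable_increment (hO : IsOracle F τ O) (a e : ℝ) (i : Fin k) :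
    Measurable fun R : Round X k m n => increment O a e R i :=
  hO.measurable_testIncrement a e measurable_fst
    ((measurable_pi_apply i).comp measurable_snd)

lemma IsOracle.measurable_weight (hO : IsOracle F τ O) (a e : ℝ) (i : Fin k) :
    Measurable fun h : Fin r → Round X k m n => weight O a e h i :=
  Finset.measurable_prod _ fun q _ =>
    ((hO.measurable_increment a e i).comp (measurable_pi_apply q)).const_add 1

end Weights

section RoundLaw

variable {X : Type*} [MeasurableSpace X] {k : ℕ} [NeZero k] (m n : ℕ)
  (D : Fin k → Measure (X × Bool)) [∀ i, IsProbabilityMeasure (D i)]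

lemma isProbabilityMeasure_roundLaw {w : Fin k → ℝ} (hw : ∀ i, 0 < w i) :
    IsProbabilityMeasure (roundLaw m n D w) := by
  have := isProbabilityMeasure_mixture D hw
  unfold roundLaw
  infer_instance

lemma measurable_roundLaw {Ω : Type*} [MeasurableSpace Ω] {w : Ω → Fin k → ℝ}
    (hw : ∀ i, Measurable fun ω => w ω i) (hw0 : ∀ ω i, 0 < w ω i) :
    Measurable fun ω => roundLaw m n D (w ω) := by
  have h_mix := fun ω => isProbabilityMeasure_mixture D (hw0 ω)
  have h_train : Measurable fun ω => Measure.pi fun _ : Fin m => mixture D (w ω) := by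
    refine .measure_of_isPiSystem_of_isProbabilityMeasure generateFrom_pi.symm isPiSystem_pi ?_
    rintro _ ⟨s, hs, rfl⟩
    simp only [Measure.pi_pi]
    exact Finset.measurable_prod _ fun j _ =>
      (Measure.measurable_coe (show MeasurableSet (s j) from hs j (Set.mem_univ j))).comp
        (measurable_mixture D hw)
  have h_round := fun ω => isProbabilityMeasure_roundLaw m n D (hw0 ω)
  refine .measure_of_isPiSystem_of_isProbabilityMeasure generateFrom_prod.symm isPiSystem_prod ?_
  rintro _ ⟨s, hs, t, -, rfl⟩
  simp only [roundLaw, Measure.prod_prod]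
  exact ((Measure.measurable_coe (show MeasurableSet s from hs)).comp h_train).mul_const _

end RoundLaw

section Measurability

lemma measurable_snoc {E : Type*} [MeasurableSpace E] (r : ℕ) :
    Measurable fun p : (Fin r → E) × E => (Fin.snoc p.1 p.2 : Fin (r + 1) → E) := by
  refine measurable_pi_iff.2 <| Fin.lastCases ?_ fun q => ?_
  · simpa only [Fin.snoc_last] using measurable_snd
  · simpa only [Fin.snoc_castSucc] using measurable_fst.eval

lemma measurable_init {E : Type*} [MeasurableSpace E] (r : ℕ) :
    Measurable fun h : Fin (r + 1) → E => (Fin.init h : Fin r → E) :=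
  measurable_pi_iff.2 fun q => measurable_pi_apply q.castSucc

lemma measurable_map_prodMk {α β γ : Type*} [MeasurableSpace α] [MeasurableSpace β]
    [MeasurableSpace γ] {μ : α → Measure β} [∀ x, IsProbabilityMeasure (μ x)] (hμ : Measurable μ)
    {f : α × β → γ} (hf : Measurable f) : Measurable fun x => (μ x).map fun y => f (x, y) := by
  let κ : Kernel α β := ⟨μ, hμ⟩
  have : IsMarkovKernel κ := ⟨‹_›⟩
  refine Measure.measurable_of_measurable_coe _ fun s hs => ?_
  have h_apply (x : α) : (μ x).map (fun y => f (x, y)) s = κ x (Prod.mk x ⁻¹' (f ⁻¹' s)) :=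
    Measure.map_apply (hf.comp measurable_prodMk_left) hs
  simp only [h_apply]
  exact Kernel.measurable_kernel_prodMk_left (κ := κ) (hf hs)

end Measurability

section RunLaw

variable {X : Type*} [MeasurableSpace X] {F : Set (X → Bool)} {τ : ℝ}
  {O : (n : ℕ) → (Fin n → X × Bool) → X → Bool} {k m n : ℕ} [NeZero k] {a e : ℝ}
  (hO : IsOracle F τ O) (ha : 0 ≤ a) (he : 0 < e)
  (D : Fin k → Measure (X × Bool)) [∀ i, IsProbabilityMeasure (D i)]

include hO ha he

lemma measurable_map_snoc (m n r : ℕ) :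
    Measurable fun h : Fin r → Round X k m n => (roundLaw m n D (weight O a e h)).map
      fun R => (Fin.snoc h R : Fin (r + 1) → Round X k m n) :=
  have := fun h : Fin r → Round X k m n =>
    isProbabilityMeasure_roundLaw m n D (weight_pos O ha he h)
  measurable_map_prodMk
    (measurable_roundLaw m n D (hO.measurable_weight a e) (weight_pos O ha he))
    (measurable_snoc r)

lemma lintegral_runLaw_succ {r : ℕ} {V : (Fin (r + 1) → Round X k m n) → ℝ≥0∞}
    (hV : Measurable V) :
    ∫⁻ h, V h ∂(runLaw O a e m n D (r + 1)) =
      ∫⁻ h, ∫⁻ R, V (Fin.snoc h R : Fin (r + 1) → Round X k m n)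
        ∂(roundLaw m n D (weight O a e h)) ∂(runLaw O a e m n D r) := by
  rw [runLaw, Measure.lintegral_bind (measurable_map_snoc hO ha he D m n r).aemeasurable
    hV.aemeasurable]
  exact lintegral_congr fun h =>
    lintegral_map hV ((measurable_snoc r).comp measurable_prodMk_left)

lemma runLaw_succ_apply {r : ℕ} {s : Set (Fin (r + 1) → Round X k m n)} (hs : MeasurableSet s) :
    runLaw O a e m n D (r + 1) s =
      ∫⁻ h, roundLaw m n D (weight O a e h) {R | (Fin.snoc h R : Fin (r + 1) → _) ∈ s}
        ∂(runLaw O a e m n D r) := by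
  rw [runLaw, Measure.bind_apply hs (measurable_map_snoc hO ha he D m n r).aemeasurable]
  exact lintegral_congr fun h =>
    Measure.map_apply ((measurable_snoc r).comp measurable_prodMk_left) hs

lemma isProbabilityMeasure_runLaw (m n r : ℕ) : IsProbabilityMeasure (runLaw O a e m n D r) := by
  induction r with
  | zero => rw [runLaw]; infer_instance
  | succ r ih =>
    have := fun h : Fin r → Round X k m n =>
      isProbabilityMeasure_roundLaw m n D (weight_pos O ha he h)
    constructor
    simp [runLaw_succ_apply hO ha he D MeasurableSet.univ]

lemma lintegral_runLaw_le_pow_mul {V : (r : ℕ) → (Fin r → Round X k m n) → ℝ≥0∞}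
    (hV : ∀ r, Measurable (V r)) {b c : ℝ≥0∞} (h_zero : V 0 Fin.elim0 ≤ b)
    (h_succ : ∀ r h, ∫⁻ R, V (r + 1) (Fin.snoc h R) ∂(roundLaw m n D (weight O a e h)) ≤
      c * V r h) (r : ℕ) :
    ∫⁻ h, V r h ∂(runLaw O a e m n D r) ≤ c ^ r * b := by
  induction r with
  | zero => simpa [runLaw, lintegral_dirac' _ (hV 0)] using h_zero
  | succ r ih =>
    rw [lintegral_runLaw_succ hO ha he D (hV _)]
    calc _ ≤ ∫⁻ h, c * V r h ∂(runLaw O a e m n D r) := lintegral_mono (h_succ r)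
      _ = c * ∫⁻ h, V r h ∂(runLaw O a e m n D r) := lintegral_const_mul _ (hV r)
      _ ≤ c ^ (r + 1) * b := by
        rw [pow_succ', mul_assoc]
        gcongr

end RunLaw

section RunGood

variable {X : Type*} [MeasurableSpace X] {F : Set (X → Bool)} {τ : ℝ}
  {O : (n : ℕ) → (Fin n → X × Bool) → X → Bool} {k m n r : ℕ} {a e P : ℝ}
  {D : Fin k → Measure (X × Bool)}

/-- The event that in each of the first `r` rounds the sample from the mixture is good. -/
def RunGood (O : (n : ℕ) → (Fin n → X × Bool) → X → Bool) (a e P : ℝ)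
    (D : Fin k → Measure (X × Bool)) : (r : ℕ) → (Fin r → Round X k m n) → Prop
  | 0, _ => True
  | r + 1, h => RunGood O a e P D r (Fin.init h) ∧
      TrainGood O a e P (mixture D (weight O a e (Fin.init h))) (h (Fin.last r)).1

lemma runGood_snoc {h : Fin r → Round X k m n} {R : Round X k m n} :
    RunGood O a e P D (r + 1) (Fin.snoc h R) ↔
      RunGood O a e P D r h ∧ TrainGood O a e P (mixture D (weight O a e h)) R.1 := by
  simp [RunGood]

lemma RunGood.empErr_le {h : Fin r → Round X k m n} (hg : RunGood O a e P D r h) (q : Fin r) :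
    empErr (h q).1 (O m (h q).1) ≤ (1 + a) * P + 4 * e := by
  induction r with
  | zero => exact q.elim0
  | succ r ih => exact Fin.lastCases hg.2.2 (ih hg.1) q

variable [∀ i, IsProbabilityMeasure (D i)]

lemma IsOracle.measurableSet_trainGood_mixture (hO : IsOracle F τ O) {Ω : Type*}
    [MeasurableSpace Ω] {w : Ω → Fin k → ℝ} (hw : ∀ i, Measurable fun ω => w ω i)
    (hw0 : ∀ ω i, 0 ≤ w ω i) {s : Ω → Fin m → X × Bool} (hs : Measurable s) :
    MeasurableSet {ω | TrainGood O a e P (mixture D (w ω)) (s ω)} := by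
  refine (measurableSet_le ?_ (hO.measurable_errBound a e hs)).inter
    (measurableSet_le (hO.measurable_empErr hs hs) measurable_const)
  simp only [fun ω => err_mixture D (hw0 ω)]
  exact Finset.measurable_sum _ (fun i _ => (hw i).mul (hO.measurable_err (D i) hs)) |>.div
    (Finset.measurable_sum _ fun i _ => hw i)

lemma IsOracle.measurableSet_runGood (hO : IsOracle F τ O) (ha : 0 ≤ a) (he : 0 < e) (r : ℕ) :
    MeasurableSet {h : Fin r → Round X k m n | RunGood O a e P D r h} := by
  induction r with
  | zero => simp [RunGood]
  | succ r ih =>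
    exact (measurable_init r ih).inter <| hO.measurableSet_trainGood_mixture
      (fun i => (hO.measurable_weight a e i).comp (measurable_init r))
      (fun h i => (weight_pos O ha he _ i).le)
      (measurable_fst.comp (measurable_pi_apply (Fin.last r)))

variable [NeZero k]

lemma runLaw_not_runGood_le (hO : IsOracle F τ O) (ha : 0 ≤ a) (he : 0 < e) {η : ℝ≥0∞}
    (hη : ∀ w : Fin k → ℝ, (∀ i, 0 < w i) → (Measure.pi fun _ : Fin m => mixture D w)
      {S | ¬ TrainGood O a e P (mixture D w) S} ≤ η) (r : ℕ) :
    runLaw O a e m n D r {h | ¬ RunGood O a e P D r h} ≤ r * η := by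
  induction r with
  | zero => simp [RunGood]
  | succ r ih =>
    have := isProbabilityMeasure_runLaw hO ha he D m n r
    have h_bad (r : ℕ) : MeasurableSet {h : Fin r → Round X k m n | ¬ RunGood O a e P D r h} :=
      (hO.measurableSet_runGood ha he r).compl
    have h_round (h : Fin r → Round X k m n) : roundLaw m n D (weight O a e h)
        {R | ¬ RunGood O a e P D (r + 1) (Fin.snoc h R)} ≤
        {h | ¬ RunGood O a e P D r h}.indicator 1 h + η := by
      have := isProbabilityMeasure_roundLaw m n D (weight_pos O ha he h)
      by_cases hg : RunGood O a e P D r h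
      · simp only [runGood_snoc, hg, true_and, Set.mem_ofPred_eq, not_true_eq_false,
          not_false_eq_true, Set.indicator_of_notMem, zero_add]
        calc roundLaw m n D (weight O a e h)
              {R | ¬ TrainGood O a e P (mixture D (weight O a e h)) R.1}
            = roundLaw m n D (weight O a e h)
              ({S | ¬ TrainGood O a e P (mixture D (weight O a e h)) S} ×ˢ Set.univ) := by
              congr 1; ext; simp
          _ ≤ η := by
              rw [roundLaw, Measure.prod_prod, measure_univ, mul_one]
              exact hη _ (weight_pos O ha he h)
      · rw [Set.indicator_of_mem (show h ∈ {h | ¬ RunGood O a e P D r h} from hg)]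
        exact prob_le_one.trans le_self_add
    calc runLaw O a e m n D (r + 1) {h | ¬ RunGood O a e P D (r + 1) h}
        ≤ ∫⁻ h, ({h | ¬ RunGood O a e P D r h}.indicator 1 h + η) ∂(runLaw O a e m n D r) := by
          rw [runLaw_succ_apply hO ha he D (h_bad _)]
          exact lintegral_mono h_round
      _ = runLaw O a e m n D r {h | ¬ RunGood O a e P D r h} + η := by
          rw [lintegral_add_right _ measurable_const, lintegral_indicator_one (h_bad r),
            lintegral_const, measure_univ, mul_one]
      _ ≤ (r + 1 : ℕ) * η := by
          push_cast
          rw [add_mul, one_mul]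
          gcongr

end RunGood

section TotalWeight

variable {X : Type*} [MeasurableSpace X] {F : Set (X → Bool)} {τ : ℝ}
  {O : (n : ℕ) → (Fin n → X × Bool) → X → Bool} {k m n : ℕ} [NeZero k] {a e : ℝ}
  {D : Fin k → Measure (X × Bool)} [∀ i, IsProbabilityMeasure (D i)]

lemma lintegral_roundLaw_sum_mul_one_add_increment_le (hO : IsOracle F τ O) (ha : 0 ≤ a)
    (he : 0 < e) (P : ℝ) (hn : n ≠ 0) {w : Fin k → ℝ} (hw : ∀ i, 0 < w i) :
    ∫⁻ R, {R : Round X k m n | TrainGood O a e P (mixture D w) R.1}.indicator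
        (fun R => ENNReal.ofReal (∑ i, w i * (1 + increment O a e R i))) R ∂(roundLaw m n D w) ≤
      ENNReal.ofReal ((1 + a ^ 2) * ∑ i, w i) := by
  classical
  have := isProbabilityMeasure_mixture D hw
  have h_good : MeasurableSet {R : Round X k m n | TrainGood O a e P (mixture D w) R.1} :=
    hO.measurableSet_trainGood_mixture (w := fun _ => w) (fun _ => measurable_const)
      (fun _ i => (hw i).le) measurable_fst
  have h_meas : Measurable fun R : Round X k m n =>
      ENNReal.ofReal (∑ i, w i * (1 + increment O a e R i)) :=
    (Finset.measurable_sum _ fun i _ =>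
      ((hO.measurable_increment a e i).const_add 1).const_mul _).ennreal_ofReal
  rw [roundLaw, lintegral_prod _ (h_meas.indicator h_good).aemeasurable]
  refine (lintegral_mono (g := fun _ => ENNReal.ofReal ((1 + a ^ 2) * ∑ i, w i))
    fun S => ?_).trans (by simp)
  by_cases hS : TrainGood O a e P (mixture D w) S
  · simp only [Set.indicator_apply, Set.mem_ofPred_eq, hS, if_true, increment_eq_testIncrement]
    exact lintegral_sum_mul_one_add_testIncrement_le D hw hn (hO.measurable_apply S) ha
      (errBound_pos O ha he S) hS.1
  · simp [hS]

lemma lintegral_weight_le (hO : IsOracle F τ O) (ha : 0 ≤ a) (he : 0 < e) (P : ℝ) (hn : n ≠ 0)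
    (r : ℕ) :
    ∫⁻ h, {h : Fin r → Round X k m n | RunGood O a e P D r h}.indicator
        (fun h => ENNReal.ofReal (∑ i, weight O a e h i)) h ∂(runLaw O a e m n D r) ≤
      ENNReal.ofReal ((1 + a ^ 2) ^ r * k) := by
  classical
  rw [ENNReal.ofReal_mul (by positivity), ENNReal.ofReal_pow (by positivity)]
  refine lintegral_runLaw_le_pow_mul hO ha he D
    (V := fun r => {h : Fin r → Round X k m n | RunGood O a e P D r h}.indicator
      fun h => ENNReal.ofReal (∑ i, weight O a e h i))
    (fun r => (Finset.measurable_sum _ fun i _ =>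
      hO.measurable_weight a e i).ennreal_ofReal.indicator (hO.measurableSet_runGood ha he r))
    (by simp [RunGood, weight]) (fun r h => ?_) r
  by_cases hg : RunGood O a e P D r h
  · simpa only [Set.indicator_apply, Set.mem_ofPred_eq, runGood_snoc, hg, true_and, weight_snoc,
      if_true, ENNReal.ofReal_mul (show 0 ≤ 1 + a ^ 2 by positivity)] using
      lintegral_roundLaw_sum_mul_one_add_increment_le (D := D) hO ha he P hn (weight_pos O ha he h)
  · simp [runGood_snoc, hg]

end TotalWeight

section GainRatio

variable {X : Type*} [MeasurableSpace X] {F : Set (X → Bool)} {τ : ℝ}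
  {O : (n : ℕ) → (Fin n → X × Bool) → X → Bool} {k m n : ℕ} {a e : ℝ}

/-- The lower bound `gain` for the expected increment of a player with distribution `D` in a round
whose sample from the mixture is `S`. -/
def roundGain (O : (n : ℕ) → (Fin n → X × Bool) → X → Bool) (a e : ℝ)
    (D : Measure (X × Bool)) (S : Fin m → X × Bool) : ℝ :=
  gain a e (errBound O a e S) (err D (O m S))

/-- The ratio between the exponential of the discounted total gain of player `i` and its weight;
it is a supermartingale. -/
def gainRatio (O : (n : ℕ) → (Fin n → X × Bool) → X → Bool) (a e : ℝ)
    (D : Fin k → Measure (X × Bool)) {r : ℕ} (h : Fin r → Round X k m n) (i : Fin k) : ℝ :=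
  Real.exp ((1 - a) * ∑ q, roundGain O a e (D i) (h q).1) / weight O a e h i

lemma gainRatio_nonneg (O : (n : ℕ) → (Fin n → X × Bool) → X → Bool) (ha : 0 ≤ a) (he : 0 < e)
    (D : Fin k → Measure (X × Bool)) {r : ℕ} (h : Fin r → Round X k m n) (i : Fin k) :
    0 ≤ gainRatio O a e D h i :=
  div_nonneg (Real.exp_nonneg _) (weight_pos O ha he h i).le

lemma gainRatio_snoc (O : (n : ℕ) → (Fin n → X × Bool) → X → Bool) (a e : ℝ)
    (D : Fin k → Measure (X × Bool)) {r : ℕ} (h : Fin r → Round X k m n) (R : Round X k m n)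
    (i : Fin k) :
    gainRatio O a e D (Fin.snoc h R : Fin (r + 1) → Round X k m n) i = gainRatio O a e D h i *
      (Real.exp ((1 - a) * roundGain O a e (D i) R.1) / (1 + increment O a e R i)) := by
  simp only [gainRatio, weight_snoc, Fin.sum_univ_castSucc, Fin.snoc_castSucc, Fin.snoc_last]
  rw [mul_add, Real.exp_add, mul_div_mul_comm]

lemma IsOracle.measurable_roundGain (hO : IsOracle F τ O) (a e : ℝ) (D : Measure (X × Bool))
    [IsProbabilityMeasure D] {Ω : Type*} [MeasurableSpace Ω] {s : Ω → Fin m → X × Bool}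
    (hs : Measurable s) : Measurable fun ω => roundGain O a e D (s ω) :=
  (measurable_gain a e).comp ((hO.measurable_errBound a e hs).prodMk (hO.measurable_err D hs))

variable {D : Fin k → Measure (X × Bool)} [∀ i, IsProbabilityMeasure (D i)]

lemma IsOracle.measurable_gainRatio (hO : IsOracle F τ O) (a e : ℝ) {r : ℕ} (i : Fin k) :
    Measurable fun h : Fin r → Round X k m n => gainRatio O a e D h i :=
  ((Finset.measurable_sum _ fun q _ => hO.measurable_roundGain a e (D i)
    (measurable_fst.comp (measurable_pi_apply q))).const_mul _).exp.div
    (hO.measurable_weight a e i)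

lemma lintegral_roundLaw_exp_roundGain_div_le_one [NeZero k] (hO : IsOracle F τ O) (ha : 0 < a)
    (ha1 : a ≤ 1) (he : 0 < e) (hn : 1 ≤ a * e * n) {w : Fin k → ℝ} (hw : ∀ i, 0 < w i)
    (i : Fin k) :
    ∫⁻ R : Round X k m n, ENNReal.ofReal (Real.exp ((1 - a) * roundGain O a e (D i) R.1) /
      (1 + increment O a e R i)) ∂(roundLaw m n D w) ≤ 1 := by
  have := isProbabilityMeasure_mixture D hw
  have h_meas : Measurable fun R : Round X k m n => ENNReal.ofReal
      (Real.exp ((1 - a) * roundGain O a e (D i) R.1) / (1 + increment O a e R i)) :=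
    (((hO.measurable_roundGain a e (D i) measurable_fst).const_mul _).exp.div
      ((hO.measurable_increment a e i).const_add 1)).ennreal_ofReal
  rw [roundLaw, lintegral_prod _ h_meas.aemeasurable]
  refine (lintegral_mono (g := fun _ => 1) fun S => ?_).trans (by simp)
  calc _ = ∫⁻ T, ENNReal.ofReal (Real.exp ((1 - a) * roundGain O a e (D i) S) /
          (1 + testIncrement a (errBound O a e S) (O m S) T))
          ∂(Measure.pi fun _ : Fin n => D i) :=
        (measurePreserving_eval
          (fun i : Fin k => Measure.pi fun _ : Fin n => D i) i).lintegral_comp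
          (((measurable_testIncrement
            (hO.measurable_apply S)).const_add 1).const_div _).ennreal_ofReal
    _ ≤ 1 := lintegral_exp_gain_div_le_one (D i) (hO.measurable_apply S) ha ha1 he.le hn
        (errBound_pos O ha.le he S)

lemma lintegral_gainRatio_le_one [NeZero k] (hO : IsOracle F τ O) (ha : 0 < a) (ha1 : a ≤ 1)
    (he : 0 < e) (hn : 1 ≤ a * e * n) (i : Fin k) (r : ℕ) :
    ∫⁻ h : Fin r → Round X k m n, ENNReal.ofReal (gainRatio O a e D h i)
      ∂(runLaw O a e m n D r) ≤ 1 := by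
  refine (lintegral_runLaw_le_pow_mul hO ha.le he D
    (V := fun _ h => ENNReal.ofReal (gainRatio O a e D h i)) (b := 1) (c := 1)
    (fun _ => (hO.measurable_gainRatio a e i).ennreal_ofReal) (by simp [gainRatio, weight])
    (fun r h => ?_) r).trans (by simp)
  simp only [gainRatio_snoc, ENNReal.ofReal_mul (gainRatio_nonneg O ha.le he D h i), one_mul]
  rw [lintegral_const_mul' _ _ ENNReal.ofReal_ne_top]
  exact mul_le_of_le_one_right' (lintegral_roundLaw_exp_roundGain_div_le_one hO ha ha1 he hn
    (weight_pos O ha.le he h) i)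

end GainRatio

section Vote

variable {a e P c t x y : ℝ}

lemma capped_le_quarter (ha : 0 ≤ a) (ha1 : a ≤ 1 / 40) (hc : 0 ≤ c) (hx : 0 ≤ x) (ht : 0 ≤ t)
    (h_total : (1 - a) * (c * (1 - a) + a * x) ≤ a * (1 + a) * t) : c ≤ t / 4 := by
  have h_lower : 39 / 40 * (c * (39 / 40)) ≤ (1 - a) * (c * (1 - a) + a * x) := by
    have h_gap : 39 / 40 ≤ 1 - a := by linarith
    have : 0 ≤ a * x := mul_nonneg ha hx
    gcongr
    exact le_add_of_le_of_nonneg (by gcongr) this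
  have h_upper : a * (1 + a) * t ≤ 1 / 40 * (1 + 1 / 40) * t := by gcongr
  linarith

lemma uncapped_le_mul (ha : 0 < a) (ha1 : a ≤ 1 / 40) (hc : 0 ≤ c) (ht : 0 ≤ t)
    (h_total : (1 - a) * (c * (1 - a) + a * x) ≤ a * (1 + a) * t) :
    x ≤ (1 - a / 2) * (2 * (1 + 3 * a)) * (t / 2 - c) := by
  have h_sq : a * a ≤ a / 40 := by nlinarith
  have h_one : 1 + a ≤ (1 - a) * ((1 - a / 2) * (1 + 3 * a)) := by
    have : 0 ≤ a * (a * a) := by positivity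
    linarith
  have h_weighted : a * ((1 - a) * (x + 2 * (1 + 3 * a) * c)) ≤ a * ((1 + a) * t) := by
    have h_small : a * (2 * (1 + 3 * a)) * c ≤ (1 - a) * c :=
      mul_le_mul_of_nonneg_right (by linarith) hc
    have := mul_le_mul_of_nonneg_left h_small (show 0 ≤ 1 - a by linarith)
    linarith
  have h_sum : x + 2 * (1 + 3 * a) * c ≤ (1 - a / 2) * (1 + 3 * a) * t := by
    refine le_of_mul_le_mul_left (a := 1 - a) ?_ (by linarith)
    calc _ ≤ (1 + a) * t := le_of_mul_le_mul_left h_weighted ha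
      _ ≤ (1 - a) * ((1 - a / 2) * (1 + 3 * a)) * t := by gcongr
      _ = _ := by ring
  have : 0 ≤ a * (1 + 3 * a) * c := by positivity
  linarith

lemma vote_error_le (ha : 0 < a) (ha1 : a ≤ 1 / 40) (he : 0 ≤ e) (hP : 0 ≤ P) (hc : 0 ≤ c)
    (hx : 0 ≤ x) (ht : 0 < t)
    (h_total : (1 - a) * (c * (1 - a) + a * x) ≤ a * (1 + a) * t)
    (h_vote : (1 - a / 2) * (y * (t / 2 - c)) ≤ ((1 + 5 * a) * P + 8 * e) * x + t * (e / 2)) :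
    y ≤ (2 + 40 * a) * P + 64 * e := by
  set B := (1 + 5 * a) * P + 8 * e with hB
  have hB0 : 0 ≤ B := by positivity
  have h_rest : t / 4 ≤ t / 2 - c := by linarith [capped_le_quarter ha.le ha1 hc hx ht.le h_total]
  have h_slack : t * (e / 2) ≤ (1 - a / 2) * (t / 2 - c) * (3 * e) := by
    have h_factor : 79 / 80 * (t / 4) ≤ (1 - a / 2) * (t / 2 - c) := by
      gcongr <;> linarith
    have : 0 ≤ t * e := by positivity
    linarith [mul_le_mul_of_nonneg_right h_factor (show 0 ≤ 3 * e by positivity)]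
  have h_main : (1 - a / 2) * (t / 2 - c) * y ≤
      (1 - a / 2) * (t / 2 - c) * (2 * (1 + 3 * a) * B + 3 * e) := by
    linarith [mul_le_mul_of_nonneg_left (uncapped_le_mul ha ha1 hc ht.le h_total) hB0]
  refine (le_of_mul_le_mul_left h_main (mul_pos (by linarith) (by linarith))).trans ?_
  have h_aaP : a * a * P ≤ 1 / 40 * a * P := by gcongr
  have h_ae : a * e ≤ 1 / 40 * e := by gcongr
  have : 0 ≤ a * P := by positivity
  rw [hB]
  linarith

end Vote

section Gain

variable {a e B q : ℝ}

lemma mul_one_sub_le_gain (ha : 0 < a) (hB : 0 < B) (heB : e ≤ B) (hq : B / a ≤ q) :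
    a * (1 - a) ≤ gain a e B q := by
  refine le_trans ?_ (le_max_right _ _)
  rw [min_eq_right hq]
  calc a * (1 - a) = a ^ 2 / B * ((1 - a / 2) * (B / a) - B / 2) := by field_simp; ring
    _ ≤ a ^ 2 / B * ((1 - a / 2) * (B / a) - e / 2) := by gcongr

lemma one_sub_half_mul_le_gain (ha : 0 < a) (hB : 0 < B) (hq : q ≤ B / a) :
    (1 - a / 2) * q ≤ B / a ^ 2 * gain a e B q + e / 2 := by
  have h_gain : a ^ 2 / B * ((1 - a / 2) * q - e / 2) ≤ gain a e B q := by
    rw [gain, min_eq_left hq]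
    exact le_max_right _ _
  calc (1 - a / 2) * q = B / a ^ 2 * (a ^ 2 / B * ((1 - a / 2) * q - e / 2)) + e / 2 := by
        field_simp; ring
    _ ≤ B / a ^ 2 * gain a e B q + e / 2 := by gcongr

lemma one_sub_half_mul_sum_le_sum_gain {ι : Type*} {s : Finset ι} {B q : ι → ℝ} {b : ℝ}
    (ha : 0 < a) (hB : ∀ r ∈ s, 0 < B r) (hBb : ∀ r ∈ s, B r ≤ b) (hq : ∀ r ∈ s, q r ≤ B r / a) :
    (1 - a / 2) * ∑ r ∈ s, q r ≤
      b * ((∑ r ∈ s, gain a e (B r) (q r)) / a ^ 2) + s.card * (e / 2) := by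
  have h_round (r : ι) (hr : r ∈ s) :
      (1 - a / 2) * q r ≤ b / a ^ 2 * gain a e (B r) (q r) + e / 2 := by
    refine (one_sub_half_mul_le_gain (e := e) ha (hB r hr) (hq r hr)).trans ?_
    have := gain_nonneg a e (B r) (q r)
    gcongr
    exact hBb r hr
  calc (1 - a / 2) * ∑ r ∈ s, q r ≤ ∑ r ∈ s, (b / a ^ 2 * gain a e (B r) (q r) + e / 2) := by
        rw [Finset.mul_sum]
        exact Finset.sum_le_sum h_round
    _ = b * ((∑ r ∈ s, gain a e (B r) (q r)) / a ^ 2) + s.card * (e / 2) := by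
        rw [Finset.sum_add_distrib, ← Finset.mul_sum, Finset.sum_const, nsmul_eq_mul]
        ring

end Gain

section Majority

variable {X : Type*} {t : ℕ}

lemma le_two_mul_card_mistake_of_maj_ne (f : Fin t → X → Bool) {x : X} {y : Bool}
    (h : maj f x ≠ y) : t ≤ 2 * (Finset.univ.filter fun r => f r x ≠ y).card := by
  have h_card := Finset.card_filter_add_card_filter_not (s := (Finset.univ : Finset (Fin t)))
    (fun r => f r x = true)
  rw [Finset.card_univ, Fintype.card_fin] at h_card
  cases y
  · have h_maj : maj f x = true := by simpa using h
    simp only [maj, decide_eq_true_eq] at h_maj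
    simp only [ne_eq, Bool.not_eq_false]
    omega
  · have h_maj : ¬ maj f x = true := h
    simp only [maj, decide_eq_true_eq] at h_maj
    simp only [ne_eq]
    omega

variable [MeasurableSpace X]

lemma measurable_maj {f : Fin t → X → Bool} (hf : ∀ r, Measurable (f r)) : Measurable (maj f) :=
  (Measurable.of_discrete (f := fun b : Fin t → Bool =>
    decide (t < 2 * (Finset.univ.filter fun r => b r = true).card))).comp (measurable_pi_iff.2 hf)

variable (D : Measure (X × Bool)) [IsProbabilityMeasure D] {f : Fin t → X → Bool}
  (hf : ∀ r, Measurable (f r))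

include hf

lemma err_maj_mul_le (K : Finset (Fin t)) :
    err D (maj f) * (t / 2 - K.card) ≤ ∑ r ∈ Kᶜ, err D (f r) := by
  have h_mem (f : X → Bool) := mistake_mem_Icc f
  have h_int {f : X → Bool} (hf : Measurable f) : Integrable (mistake f) D :=
    integrable_of_mem_Icc (measurable_mistake hf) (mistake_mem_Icc f)
  have h_pointwise (z : X × Bool) :
      mistake (maj f) z * (t / 2 - K.card) ≤ ∑ r ∈ Kᶜ, mistake (f r) z := by
    by_cases hz : maj f z.1 = z.2
    · rw [show mistake (maj f) z = 0 by simp [mistake, hz], zero_mul]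
      exact Finset.sum_nonneg fun r _ => (h_mem (f r) z).1
    · rw [show mistake (maj f) z = 1 by simp [mistake, hz], one_mul]
      have h_half : (t : ℝ) ≤ 2 * (Finset.univ.filter fun r => f r z.1 ≠ z.2).card := by
        exact_mod_cast le_two_mul_card_mistake_of_maj_ne f hz
      have h_total : ∑ r, mistake (f r) z = (Finset.univ.filter fun r => f r z.1 ≠ z.2).card := by
        simp [mistake, Finset.sum_ite]
      have h_excluded : ∑ r ∈ K, mistake (f r) z ≤ K.card := by
        simpa using Finset.sum_le_sum fun r (_ : r ∈ K) => (h_mem (f r) z).2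
      linarith [Finset.sum_add_sum_compl K fun r => mistake (f r) z]
  rw [← integral_mistake D (measurable_maj hf), ← integral_mul_const]
  simp only [← integral_mistake D (hf _)]
  rw [← integral_finsetSum _ fun r _ => h_int (hf r)]
  exact integral_mono ((h_int (measurable_maj hf)).mul_const _)
    (integrable_finsetSum _ fun r _ => h_int (hf r)) h_pointwise

lemma err_maj_le_of_sum_gain_le (ht : 0 < t) {a e P : ℝ} (ha : 0 < a) (ha1 : a ≤ 1 / 40)
    (he : 0 < e) (hP : 0 ≤ P) {B : Fin t → ℝ} (heB : ∀ r, e ≤ B r)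
    (hB : ∀ r, B r ≤ (1 + 5 * a) * P + 8 * e)
    (h_gain : (1 - a) * ∑ r, gain a e (B r) (err D (f r)) ≤ a ^ 2 * t * (1 + a)) :
    err D (maj f) ≤ (2 + 40 * a) * P + 64 * e := by
  classical
  have hB0 (r : Fin t) : 0 < B r := he.trans_le (heB r)
  set G : Fin t → ℝ := fun r => gain a e (B r) (err D (f r))
  -- the rounds in which the error is so large that the cap `a` limits the expected increment
  set K : Finset (Fin t) := Finset.univ.filter fun r => B r / a < err D (f r)
  have h_capped : K.card * (a * (1 - a)) ≤ ∑ r ∈ K, G r := by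
    rw [← nsmul_eq_mul]
    exact Finset.card_nsmul_le_sum K G _ fun r hr =>
      mul_one_sub_le_gain ha (hB0 r) (heB r) (Finset.mem_filter.1 hr).2.le
  set x := (∑ r ∈ Kᶜ, G r) / a ^ 2 with hx
  have h_uncapped_sum : ∑ r ∈ Kᶜ, G r = a ^ 2 * x := by rw [hx]; field_simp
  have h_uncapped : (1 - a / 2) * ∑ r ∈ Kᶜ, err D (f r) ≤
      ((1 + 5 * a) * P + 8 * e) * x + t * (e / 2) := by
    have h_card : (Kᶜ.card : ℝ) ≤ t :=
      Nat.cast_le.2 ((Finset.card_le_univ _).trans_eq (Fintype.card_fin t))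
    refine (one_sub_half_mul_sum_le_sum_gain (e := e) ha (fun r _ => hB0 r) (fun r _ => hB r)
      fun r hr => by simpa [K] using hr).trans ?_
    rw [← hx]
    gcongr
  refine vote_error_le (c := K.card) (t := t) (x := x) ha ha1 he.le hP (Nat.cast_nonneg _)
    (div_nonneg (Finset.sum_nonneg fun r _ => gain_nonneg _ _ _ _) (by positivity))
    (mod_cast ht) ?_ ?_
  · refine le_of_mul_le_mul_left (a := a) ?_ ha
    have h_split := Finset.sum_add_sum_compl K G
    have : (1 - a) * (K.card * (a * (1 - a)) + a ^ 2 * x) ≤ (1 - a) * ∑ r, G r :=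
      mul_le_mul_of_nonneg_left (by linarith) (by linarith)
    linarith
  · exact (mul_le_mul_of_nonneg_left (err_maj_mul_le D hf K) (by linarith)).trans h_uncapped

end Majority

section TypicalRun

variable {X : Type*} [MeasurableSpace X] {F : Set (X → Bool)} {τ : ℝ}
  {O : (n : ℕ) → (Fin n → X × Bool) → X → Bool} {k m n r : ℕ} {a e P Λ : ℝ}
  {D : Fin k → Measure (X × Bool)}

lemma measure_lt_le_of_lintegral_le {Ω : Type*} [MeasurableSpace Ω] {μ : Measure Ω}
    {g : Ω → ℝ} {s : Set Ω} {b c : ℝ} (hg : AEMeasurable g μ) (hs : MeasurableSet s) (hc : 0 < c)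
    (hb : ∫⁻ ω, s.indicator (fun ω => ENNReal.ofReal (g ω)) ω ∂μ ≤ ENNReal.ofReal b) :
    μ {ω | ω ∈ s ∧ c < g ω} ≤ ENNReal.ofReal (b / c) := by
  calc μ {ω | ω ∈ s ∧ c < g ω}
      ≤ μ {ω | ENNReal.ofReal c ≤ s.indicator (fun ω => ENNReal.ofReal (g ω)) ω} :=
        measure_mono fun ω hω => by
          simpa [Set.indicator_of_mem hω.1] using ENNReal.ofReal_le_ofReal hω.2.le
    _ ≤ ENNReal.ofReal b / ENNReal.ofReal c :=
        (meas_ge_le_lintegral_div (hg.ennreal_ofReal.indicator hs) (by simpa using hc)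
          ENNReal.ofReal_ne_top).trans (by gcongr)
    _ = ENNReal.ofReal (b / c) := (ENNReal.ofReal_div_of_pos hc).symm

/-- A run on which the analysis succeeds: all samples from the mixtures are good, the total weight
is at most `Λ` times its expected size, and no weight is less than `Λ⁻¹` times the exponential of
the discounted total gain of its player. -/
structure TypicalRun (O : (n : ℕ) → (Fin n → X × Bool) → X → Bool) (a e P Λ : ℝ)
    (D : Fin k → Measure (X × Bool)) (h : Fin r → Round X k m n) : Prop where
  runGood : RunGood O a e P D r h
  sum_weight_le : ∑ i, weight O a e h i ≤ Λ * (1 + a ^ 2) ^ r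
  gainRatio_le : ∀ i, gainRatio O a e D h i ≤ Λ

lemma runLaw_not_typicalRun_le [NeZero k] [∀ i, IsProbabilityMeasure (D i)]
    (hO : IsOracle F τ O) (ha : 0 < a) (ha1 : a ≤ 1) (he : 0 < e) (hΛ : 0 < Λ)
    (hn : 1 ≤ a * e * n) {η : ℝ≥0∞}
    (hη : ∀ w : Fin k → ℝ, (∀ i, 0 < w i) → (Measure.pi fun _ : Fin m => mixture D w)
      {S | ¬ TrainGood O a e P (mixture D w) S} ≤ η) :
    runLaw O a e m n D r {h | ¬ TypicalRun O a e P Λ D h} ≤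
      r * η + ENNReal.ofReal (k / Λ) + ENNReal.ofReal (k / Λ) := by
  have hn0 : n ≠ 0 := by rintro rfl; norm_num at hn
  set μ := runLaw O a e m n D r
  have h_weight : μ {h | RunGood O a e P D r h ∧
      Λ * (1 + a ^ 2) ^ r < ∑ i, weight O a e h i} ≤ ENNReal.ofReal (k / Λ) := by
    refine (measure_lt_le_of_lintegral_le
      (Finset.measurable_sum _ fun i _ => hO.measurable_weight a e i).aemeasurable
      (hO.measurableSet_runGood ha.le he r) (by positivity)
      (lintegral_weight_le hO ha.le he P hn0 r)).trans_eq ?_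
    congr 1
    field_simp
  have h_ratio (i : Fin k) : μ {h | Λ < gainRatio O a e D h i} ≤ ENNReal.ofReal (1 / Λ) := by
    simpa using measure_lt_le_of_lintegral_le (μ := μ) (s := Set.univ) (b := 1)
      (hO.measurable_gainRatio a e i).aemeasurable MeasurableSet.univ hΛ
      (by simpa using lintegral_gainRatio_le_one hO ha ha1 he hn i r)
  calc μ {h | ¬ TypicalRun O a e P Λ D h}
      ≤ μ ({h | ¬ RunGood O a e P D r h} ∪ {h | RunGood O a e P D r h ∧
          Λ * (1 + a ^ 2) ^ r < ∑ i, weight O a e h i} ∪ ⋃ i, {h | Λ < gainRatio O a e D h i}) := by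
        refine measure_mono fun h hh => ?_
        by_contra hc
        simp only [Set.mem_union, Set.mem_iUnion, Set.mem_ofPred_eq, not_or, not_and, not_not,
          not_exists, not_lt] at hc
        exact hh ⟨hc.1.1, hc.1.2 hc.1.1, hc.2⟩
    _ ≤ r * η + ENNReal.ofReal (k / Λ) + ∑ _i : Fin k, ENNReal.ofReal (1 / Λ) :=
        (measure_union_le _ _).trans <| add_le_add ((measure_union_le _ _).trans <|
          add_le_add (runLaw_not_runGood_le hO ha.le he hη r) h_weight) <|
          (measure_iUnion_fintype_le μ _).trans <| Finset.sum_le_sum fun i _ => h_ratio i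
    _ = r * η + ENNReal.ofReal (k / Λ) + ENNReal.ofReal (k / Λ) := by
        rw [Finset.sum_const, Finset.card_univ, Fintype.card_fin, nsmul_eq_mul,
          ← ENNReal.ofReal_natCast k, ← ENNReal.ofReal_mul (by positivity), mul_one_div]

lemma TypicalRun.sum_roundGain_le {h : Fin r → Round X k m n}
    (hh : TypicalRun O a e P Λ D h) (ha : 0 ≤ a) (he : 0 < e) (hΛ : 0 < Λ) (i : Fin k) :
    (1 - a) * ∑ q, roundGain O a e (D i) (h q).1 ≤ 2 * Real.log Λ + r * a ^ 2 := by
  have h_pos := weight_pos O ha he h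
  have h_single : weight O a e h i ≤ ∑ i, weight O a e h i :=
    Finset.single_le_sum (fun j _ => (h_pos j).le) (Finset.mem_univ i)
  have h_pow : (1 + a ^ 2) ^ r ≤ Real.exp (r * a ^ 2) := by
    rw [Real.exp_nat_mul]
    gcongr
    linarith [Real.add_one_le_exp (a ^ 2)]
  rw [← Real.exp_le_exp]
  calc Real.exp ((1 - a) * ∑ q, roundGain O a e (D i) (h q).1)
      ≤ Λ * weight O a e h i := (div_le_iff₀ (h_pos i)).1 (hh.gainRatio_le i)
    _ ≤ Λ * (Λ * Real.exp (r * a ^ 2)) := by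
        gcongr
        exact (h_single.trans hh.sum_weight_le).trans (by gcongr)
    _ = Real.exp (2 * Real.log Λ + r * a ^ 2) := by
        rw [Real.exp_add, two_mul, Real.exp_add, Real.exp_log hΛ, mul_assoc]

lemma TypicalRun.err_maj_le [∀ i, IsProbabilityMeasure (D i)] {h : Fin r → Round X k m n}
    (hh : TypicalRun O a e P Λ D h) (hO : IsOracle F τ O) (ha : 0 < a) (ha1 : a ≤ 1 / 40)
    (he : 0 < e) (hP : 0 ≤ P) (hr : 0 < r) (hΛ : 0 < Λ) (hlog : 2 * Real.log Λ ≤ a ^ 3 * r)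
    (i : Fin k) :
    err (D i) (maj fun q => roundClassifier O (h q)) ≤ (2 + 40 * a) * P + 64 * e := by
  refine err_maj_le_of_sum_gain_le (D i) (fun q => hO.measurable_apply _) hr ha ha1 he hP
    (B := fun q => errBound O a e (h q).1) (fun q => ?_) (fun q => ?_)
    ?_
  · have := empErr_nonneg (h q).1 (O m (h q).1)
    have : 0 ≤ (1 + 3 * a) * empErr (h q).1 (O m (h q).1) := by positivity
    unfold errBound
    linarith
  · have h_emp := mul_le_mul_of_nonneg_left (hh.runGood.empErr_le q) (by linarith : 0 ≤ 1 + 3 * a)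
    unfold errBound
    nlinarith [mul_nonneg (mul_nonneg ha.le hP) (sub_nonneg.2 ha1),
      mul_nonneg he.le (sub_nonneg.2 ha1)]
  · change (1 - a) * ∑ q, roundGain O a e (D i) (h q).1 ≤ _
    linarith [hh.sum_roundGain_le ha.le he hΛ i]

end TypicalRun

section SampleSizes

variable {k d : ℕ} {a e x α δ ε η M v C : ℝ}

lemma one_le_log_of_three_le (hx : 3 ≤ x) : 1 ≤ Real.log x :=
  (Real.le_log_iff_exp_le (by linarith)).2 (Real.exp_one_lt_three.le.trans hx)

lemma mul_le_mul_natCeil (hv : 0 < v) (C x : ℝ) : C * x ≤ v * ⌈C / v * x⌉₊ := by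
  rw [← div_le_iff₀' hv, ← div_mul_eq_mul_div]
  exact Nat.le_ceil _

lemma mul_natCeil_le (hv : 0 < v) (hv1 : v ≤ 1) (hC : 0 ≤ C) (hx : 0 ≤ x) :
    v * ⌈C / v * x⌉₊ ≤ C * x + 1 := by
  calc v * ⌈C / v * x⌉₊ ≤ v * (C / v * x + 1) := by
        gcongr
        exact (Nat.ceil_lt_add_one (by positivity)).le
    _ = C * x + v := by field_simp
    _ ≤ C * x + 1 := by gcongr

lemma one_le_log_four_mul_div (hk : 1 ≤ k) (hδ : 0 < δ) (hδ1 : δ < 1) :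
    1 ≤ Real.log (4 * k / δ) := by
  have hk' : (1 : ℝ) ≤ k := mod_cast hk
  refine one_le_log_of_three_le ?_
  rw [le_div_iff₀ hδ]
  linarith

lemma two_mul_log_le_mul_numRounds (hα : 0 < α) :
    2 * Real.log (4 * k / δ) ≤ (α / 40) ^ 3 * numRounds k α δ := by
  have h_ceil := Nat.le_ceil (Real.log (4 * k / δ) / (α / 40) ^ 3)
  rw [div_le_iff₀' (by positivity)] at h_ceil
  rw [numRounds]
  push_cast
  linarith

lemma two_le_numRounds (hk : 1 ≤ k) (hα : 0 < α) (hδ : 0 < δ) (hδ1 : δ < 1) :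
    2 ≤ numRounds k α δ := by
  have := one_le_log_four_mul_div hk hδ hδ1
  have : 0 < ⌈Real.log (4 * k / δ) / (α / 40) ^ 3⌉₊ := Nat.ceil_pos.2 (by positivity)
  unfold numRounds
  omega

lemma div_four_mul_numRounds_le (hk : 1 ≤ k) (hα : 0 < α) (hδ : 0 < δ) (hδ1 : δ < 1) :
    δ / (4 * numRounds k α δ) ≤ 1 / 8 := by
  have h_rounds : (2 : ℝ) ≤ numRounds k α δ := mod_cast two_le_numRounds hk hα hδ hδ1
  rw [div_le_div_iff₀ (by positivity) (by norm_num)]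
  linarith

lemma one_le_mul_testSize (hα : 0 < α) (hα1 : α < 1) (hε : 0 < ε) :
    1 ≤ α / 40 * (ε / 64) * testSize 1 ε α := by
  have h_log : 1 ≤ Real.log (1 / (α / 40)) := by
    refine one_le_log_of_three_le ?_
    rw [le_div_iff₀ (by positivity)]
    linarith
  have := mul_le_mul_natCeil (v := α / 40 * (ε / 64)) (by positivity) 1 (Real.log (1 / (α / 40)))
  unfold testSize
  linarith

lemma log_eight_div_le (he : 0 < e) (he1 : e ≤ 1 / 64) (hea : 2 * e ≤ a) :
    Real.log (8 / (a * e)) ≤ 3 * Real.log (1 / e) := by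
  have h_log : 3 * Real.log (1 / e) = Real.log (1 / e ^ 3) := by
    rw [one_div, one_div, Real.log_inv, Real.log_inv, Real.log_pow]
    push_cast
    ring
  have ha : 0 < a := by linarith
  have h_cube : 8 * e ^ 3 ≤ a * e := by
    calc 8 * e ^ 3 = 4 * e * (2 * e * e) := by ring
      _ ≤ 1 * (a * e) := by gcongr; linarith
      _ = a * e := one_mul _
  rw [h_log]
  refine Real.log_le_log (by positivity) ?_
  rwa [div_le_div_iff₀ (by positivity) (by positivity), one_mul]

lemma two_le_of_four_mul_log_le (hη : 0 < η) (hη1 : η ≤ 1 / 8) (he : 0 < e) (he1 : e ≤ 1)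
    (hM : 4 * (d * Real.log (1 / e) + Real.log (1 / η)) ≤ M) : 2 ≤ M := by
  have h_log : 1 ≤ Real.log (1 / η) := by
    refine one_le_log_of_three_le ?_
    rw [le_div_iff₀ hη]
    linarith
  have : 0 ≤ d * Real.log (1 / e) :=
    mul_nonneg d.cast_nonneg (Real.log_nonneg (one_le_one_div he he1))
  linarith

lemma two_mul_exp_add_exp_le (hη : 0 < η) (hη1 : η ≤ 1 / 8) (he : 0 < e) (he1 : e ≤ 1 / 64)
    (hea : 2 * e ≤ a) (hM : 4 * (d * Real.log (1 / e) + Real.log (1 / η)) ≤ M) :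
    2 * Real.exp (d * Real.log (8 / (a * e)) - 3 / 4 * M) + Real.exp (-M) ≤ η := by
  have h_exp : Real.exp (-(3 * Real.log (1 / η))) = η ^ 3 := by
    rw [one_div, Real.log_inv, mul_neg, neg_neg, ← Real.exp_log (pow_pos hη 3), Real.log_pow]
    norm_num
  have h_vc : d * Real.log (8 / (a * e)) ≤ d * (3 * Real.log (1 / e)) := by
    gcongr
    exact log_eight_div_le he he1 hea
  have h_dim : 0 ≤ d * Real.log (1 / e) :=
    mul_nonneg d.cast_nonneg (Real.log_nonneg (one_le_one_div he (by linarith)))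
  have h_conf : 0 ≤ Real.log (1 / η) := Real.log_nonneg (one_le_one_div hη (by linarith))
  calc 2 * Real.exp (d * Real.log (8 / (a * e)) - 3 / 4 * M) + Real.exp (-M)
      ≤ 2 * Real.exp (-(3 * Real.log (1 / η))) + Real.exp (-(3 * Real.log (1 / η))) := by
        gcongr <;> linarith
    _ = 3 * η * (η * η) := by rw [h_exp]; ring
    _ ≤ 3 * η * (1 / 8 * (1 / 8)) := by gcongr
    _ ≤ η := by linarith

end SampleSizes

section Accuracy

variable {X : Type*} [MeasurableSpace X] {F : Set (X → Bool)}
  {O : (n : ℕ) → (Fin n → X × Bool) → X → Bool} {k d : ℕ} {α δ ε : ℝ}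

lemma OPT_nonneg (F : Set (X → Bool)) (D : Fin k → Measure (X × Bool)) : 0 ≤ OPT F D :=
  Real.iInf_nonneg fun f => Real.iSup_nonneg fun i => err_nonneg (D i) f.1

lemma exists_err_le_OPT_add (hF : F.Nonempty) (D : Fin k → Measure (X × Bool)) {e : ℝ}
    (he : 0 < e) : ∃ f ∈ F, ∀ i, err (D i) f ≤ OPT F D + e := by
  have : Nonempty F := hF.to_subtype
  obtain ⟨f, hf⟩ := exists_lt_of_ciInf_lt (show OPT F D < OPT F D + e by linarith)
  exact ⟨f.1, f.2, fun i =>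
    (le_ciSup (f := fun i => err (D i) f.1) (Set.finite_range _).bddAbove i).trans hf.le⟩

lemma one_sub_le_measureReal_of_imp {Ω : Type*} [MeasurableSpace Ω] {μ : Measure Ω}
    [IsProbabilityMeasure μ] {p q : Ω → Prop} (hδ : 0 ≤ δ)
    (hp : μ {ω | ¬ p ω} ≤ ENNReal.ofReal δ) (hpq : ∀ ω, p ω → q ω) :
    1 - δ ≤ μ.real {ω | q ω} := by
  have h_cover : {ω | q ω} ∪ {ω | ¬ p ω} = Set.univ :=
    Set.eq_univ_of_forall fun ω => (em (p ω)).imp (hpq ω) id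
  have h_union := measureReal_union_le (μ := μ) {ω | q ω} {ω | ¬ p ω}
  rw [h_cover, probReal_univ] at h_union
  linarith [ENNReal.toReal_le_of_le_ofReal hδ hp, measureReal_def μ {ω | ¬ p ω}]

variable [NeZero k] (D : Fin k → Measure (X × Bool)) [∀ i, IsProbabilityMeasure (D i)]

lemma err_mixture_le {w : Fin k → ℝ} (hw : ∀ i, 0 < w i) {f : X → Bool} {b : ℝ}
    (hf : ∀ i, err (D i) f ≤ b) : err (mixture D w) f ≤ b := by
  have h_total : 0 < ∑ i, w i := Finset.sum_pos (fun i _ => hw i) Finset.univ_nonempty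
  rw [err_mixture D fun i => (hw i).le, div_le_iff₀ h_total, Finset.mul_sum]
  exact Finset.sum_le_sum fun i _ => by linarith [mul_le_mul_of_nonneg_left (hf i) (hw i).le]

lemma IsOracle.nr2Law_not_typicalRun_le (hO : IsOracle F (ε / 64) O)
    (hF : ∀ f ∈ F, Measurable f) (hd : vcDim F ≤ d) (hε : 0 < ε) (hδ : 0 < δ) (hδ1 : δ < 1)
    (hεα : 5 * ε / 4 < α) (hα1 : α < 1) :
    nr2Law 4 1 d ε δ α O D
      {h | ¬ TypicalRun O (α / 40) (ε / 64) (OPT F D) (4 * k / δ) D h} ≤ ENNReal.ofReal δ := by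
  have hk : 1 ≤ k := NeZero.one_le
  have hα : 0 < α := by linarith
  have he : 0 < ε / 64 := by positivity
  have h_rounds : 0 < numRounds k α δ := by have := two_le_numRounds hk hα hδ hδ1; omega
  have h_conf : 0 < δ / (4 * numRounds k α δ) := by positivity
  have h_conf_le := div_four_mul_numRounds_le hk hα hδ hδ1
  have h_train : 4 * (d * Real.log (1 / (ε / 64)) +
      Real.log (1 / (δ / (4 * numRounds k α δ)))) ≤
        α / 40 * (ε / 64) * trainSize 4 k d ε δ α :=
    mul_le_mul_natCeil (by positivity) _ _
  have h_two := two_le_of_four_mul_log_le h_conf h_conf_le he (by linarith) h_train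
  have h_fail := two_mul_exp_add_exp_le (a := α / 40) h_conf h_conf_le he (by linarith)
    (by linarith) h_train
  obtain ⟨f, hfF, hf⟩ := exists_err_le_OPT_add ⟨_, hO.mem 0 Fin.elim0⟩ D he
  refine (runLaw_not_typicalRun_le (Λ := 4 * k / δ)
    (η := ENNReal.ofReal (δ / (4 * numRounds k α δ))) hO (by positivity) (by linarith) he
    (by positivity) (one_le_mul_testSize hα hα1 hε) fun w hw => ?_).trans ?_
  · have := isProbabilityMeasure_mixture D hw
    exact (hO.pi_not_trainGood_le hd (mixture D w) (by positivity) (by linarith) he (by linarith)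
      h_two hfF (hF f hfF) (err_mixture_le D hw hf)).trans (ENNReal.ofReal_le_ofReal h_fail)
  · have h_quarter : (numRounds k α δ : ℝ) * (δ / (4 * numRounds k α δ)) = δ / 4 := by
      field_simp
    have h_markov : (k : ℝ) / (4 * k / δ) = δ / 4 := by field_simp
    rw [h_markov, ← ENNReal.ofReal_natCast, ← ENNReal.ofReal_mul (Nat.cast_nonneg _), h_quarter,
      ← ENNReal.ofReal_add (by positivity) (by positivity),
      ← ENNReal.ofReal_add (by positivity) (by positivity)]
    exact ENNReal.ofReal_le_ofReal (by linarith)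

lemma IsOracle.one_sub_le_nr2Law (hO : IsOracle F (ε / 64) O) (hF : ∀ f ∈ F, Measurable f)
    (hd : vcDim F ≤ d) (hε : 0 < ε) (hδ : 0 < δ) (hδ1 : δ < 1) (hεα : 5 * ε / 4 < α)
    (hα1 : α < 1) :
    1 - δ ≤ (nr2Law 4 1 d ε δ α O D).real
      {h | ∀ i, err (D i) (nr2Output O h) ≤ (2 + α) * OPT F D + ε} := by
  have hk : 1 ≤ k := NeZero.one_le
  have hα : 0 < α := by linarith
  have : IsProbabilityMeasure (nr2Law 4 1 d ε δ α O D) :=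
    isProbabilityMeasure_runLaw hO (by positivity) (by positivity) D _ _ _
  refine one_sub_le_measureReal_of_imp hδ.le
    (hO.nr2Law_not_typicalRun_le D hF hd hε hδ hδ1 hεα hα1) fun h hh i => ?_
  have h_rounds := two_le_numRounds hk hα hδ hδ1
  refine (hh.err_maj_le hO (by positivity) (by linarith) (by positivity) (OPT_nonneg F D)
    (by omega) (by positivity) (two_mul_log_le_mul_numRounds hα) i).trans_eq ?_
  ring

end Accuracy

section SampleCount

variable {k d : ℕ} {ε δ α : ℝ}

lemma numRounds_le (hk : 1 ≤ k) (hα : 0 < α) (hα1 : α < 1) (hδ : 0 < δ) (hδ1 : δ < 1) :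
    (numRounds k α δ : ℝ) ≤ 256000 * Real.log (4 * k / δ) / α ^ 3 := by
  have h_log := one_le_log_four_mul_div hk hδ hδ1
  have h_scale : Real.log (4 * k / δ) / (α / 40) ^ 3 = 64000 * Real.log (4 * k / δ) / α ^ 3 := by
    field_simp
    norm_num
  have h_one : 1 ≤ 64000 * Real.log (4 * k / δ) / α ^ 3 := by
    rw [le_div_iff₀ (by positivity), one_mul]
    linarith [pow_le_one₀ (n := 3) hα.le hα1.le]
  have h_ceil := Nat.ceil_lt_add_one (zero_le_one.trans h_one)
  rw [numRounds, h_scale]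
  push_cast
  calc _ ≤ 4 * (64000 * Real.log (4 * k / δ) / α ^ 3) := by linarith
    _ = _ := by ring

lemma numRounds_le_log_two_mul (hk : 1 ≤ k) (hα : 0 < α) (hα1 : α < 1) (hδ : 0 < δ)
    (hδ1 : δ < 1) : (numRounds k α δ : ℝ) ≤ 512000 * Real.log (2 * k / δ) / α ^ 3 := by
  have hk' : (1 : ℝ) ≤ k := mod_cast hk
  have h_two : Real.log 2 ≤ Real.log (2 * k / δ) :=
    Real.log_le_log two_pos (by rw [le_div_iff₀ hδ]; linarith)
  have h_four : Real.log (4 * k / δ) = Real.log 2 + Real.log (2 * k / δ) := by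
    rw [← Real.log_mul two_ne_zero (by positivity)]
    congr 1
    ring
  refine (numRounds_le hk hα hα1 hδ hδ1).trans ?_
  gcongr ?_ / _
  linarith

lemma log_two_le_log_two_div (hα : 0 < α) (hα1 : α ≤ 1) : Real.log 2 ≤ Real.log (2 / α) :=
  Real.log_le_log two_pos (le_div_self zero_le_two hα hα1)

lemma half_le_log_two_div (hα : 0 < α) (hα1 : α ≤ 1) : 1 / 2 ≤ Real.log (2 / α) := by
  linarith [Real.log_two_gt_d9, log_two_le_log_two_div hα hα1]

lemma one_div_div_numRounds_le (hk : 1 ≤ k) (hα : 0 < α) (hα1 : α < 1) (hδ : 0 < δ)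
    (hδ1 : δ < 1) :
    1 / (δ / (4 * numRounds k α δ)) ≤ 2 ^ 22 * k * (1 / δ) ^ 2 * (1 / α) ^ 3 := by
  have h_log : Real.log (4 * k / δ) ≤ 4 * k / δ := Real.log_le_self (by positivity)
  calc 1 / (δ / (4 * numRounds k α δ)) = 4 / δ * numRounds k α δ := by field_simp
    _ ≤ 4 / δ * (256000 * (4 * k / δ) / α ^ 3) := by
        gcongr
        exact (numRounds_le hk hα hα1 hδ hδ1).trans (by gcongr)
    _ = 4096000 * (k * (1 / δ) ^ 2 * (1 / α) ^ 3) := by ring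
    _ ≤ 2 ^ 22 * (k * (1 / δ) ^ 2 * (1 / α) ^ 3) := by gcongr; norm_num
    _ = 2 ^ 22 * k * (1 / δ) ^ 2 * (1 / α) ^ 3 := by ring

lemma log_one_div_div_numRounds_le (hk : 1 ≤ k) (hα : 0 < α) (hα1 : α < 1) (hδ : 0 < δ)
    (hδ1 : δ < 1) : Real.log (1 / (δ / (4 * numRounds k α δ))) ≤
      27 * (k * Real.log (2 / α)) + 2 * Real.log (1 / δ) := by
  have hk' : (1 : ℝ) ≤ k := mod_cast hk
  have h_rounds : (0 : ℝ) < numRounds k α δ := by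
    exact_mod_cast two_pos.trans_le (two_le_numRounds hk hα hδ hδ1)
  have h_two := log_two_le_log_two_div hα hα1.le
  have h_half := half_le_log_two_div hα hα1.le
  have h_players : Real.log k ≤ 2 * (k * Real.log (2 / α)) := by
    have := mul_le_mul_of_nonneg_left h_half (zero_le_one.trans hk')
    linarith [Real.log_le_self (zero_le_one.trans hk')]
  have h_single : Real.log (2 / α) ≤ k * Real.log (2 / α) :=
    le_mul_of_one_le_left (by linarith) hk'
  have h_alpha : Real.log (1 / α) ≤ Real.log (2 / α) :=
    Real.log_le_log (by positivity) (by gcongr; norm_num)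
  calc Real.log (1 / (δ / (4 * numRounds k α δ)))
      ≤ Real.log (2 ^ 22 * k * (1 / δ) ^ 2 * (1 / α) ^ 3) :=
        Real.log_le_log (by positivity) (one_div_div_numRounds_le hk hα hα1 hδ hδ1)
    _ = 22 * Real.log 2 + Real.log k + 2 * Real.log (1 / δ) + 3 * Real.log (1 / α) := by
        rw [Real.log_mul (by positivity) (by positivity),
          Real.log_mul (by positivity) (by positivity),
          Real.log_mul (by positivity) (by positivity), Real.log_pow, Real.log_pow, Real.log_pow]
        norm_num
    _ ≤ 27 * (k * Real.log (2 / α)) + 2 * Real.log (1 / δ) := by linarith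

lemma log_one_div_div_sixtyFour_le (hε : 0 < ε) (hε1 : 5 * ε / 4 ≤ 1) :
    Real.log (1 / (ε / 64)) ≤ 20 * Real.log (1 / ε) := by
  have h_eps : Real.log (5 / 4) ≤ Real.log (1 / ε) :=
    Real.log_le_log (by norm_num) (by rw [le_div_iff₀ hε]; linarith)
  have h_const : Real.log 64 ≤ 19 * Real.log (5 / 4) := by
    have := Real.log_le_log (by norm_num) (show (64 : ℝ) ≤ (5 / 4) ^ 19 by norm_num)
    rwa [Real.log_pow] at this
  rw [one_div_div, div_eq_mul_one_div, Real.log_mul (by norm_num) (by positivity)]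
  linarith

lemma log_one_div_div_forty_le (hα : 0 < α) (hα1 : α ≤ 1) :
    Real.log (1 / (α / 40)) ≤ 6 * Real.log (2 / α) := by
  have h_const : Real.log 20 ≤ 5 * Real.log 2 := by
    have := Real.log_le_log (by norm_num) (show (20 : ℝ) ≤ 2 ^ 5 by norm_num)
    rwa [Real.log_pow] at this
  rw [one_div_div, show 40 / α = 20 * (2 / α) by ring, Real.log_mul (by norm_num) (by positivity)]
  linarith [log_two_le_log_two_div hα hα1]

lemma mul_trainSize_le (hk : 1 ≤ k) (hε : 0 < ε) (hδ : 0 < δ) (hδ1 : δ < 1)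
    (hεα : 5 * ε / 4 < α) (hα1 : α < 1) :
    α / 40 * (ε / 64) * trainSize 4 k d ε δ α ≤
      110 * (d * Real.log (1 / ε) + k * Real.log (2 / α) + Real.log (1 / δ)) := by
  have hα : 0 < α := by linarith
  have hk' : (1 : ℝ) ≤ k := mod_cast hk
  have h_rounds : (2 : ℝ) ≤ numRounds k α δ := mod_cast two_le_numRounds hk hα hδ hδ1
  have h_vc_nonneg : 0 ≤ d * Real.log (1 / (ε / 64)) :=
    mul_nonneg d.cast_nonneg (Real.log_nonneg (one_le_one_div (by positivity) (by linarith)))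
  have h_conf_nonneg : 0 ≤ Real.log (1 / (δ / (4 * numRounds k α δ))) :=
    Real.log_nonneg (one_le_one_div (by positivity)
      ((div_four_mul_numRounds_le hk hα hδ hδ1).trans (by norm_num)))
  have h_ceil := mul_natCeil_le (v := α / 40 * (ε / 64)) (by positivity)
    (mul_le_one₀ (by linarith) (by positivity) (by linarith)) zero_le_four
    (add_nonneg h_vc_nonneg h_conf_nonneg)
  have h_vc : d * Real.log (1 / (ε / 64)) ≤ d * (20 * Real.log (1 / ε)) :=
    mul_le_mul_of_nonneg_left (log_one_div_div_sixtyFour_le hε (by linarith)) d.cast_nonneg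
  have h_conf := log_one_div_div_numRounds_le hk hα hα1 hδ hδ1
  have h_delta : 0 ≤ Real.log (1 / δ) := Real.log_nonneg (one_le_one_div hδ hδ1.le)
  have h_half : 1 * (1 / 2) ≤ k * Real.log (2 / α) := by
    gcongr
    exact half_le_log_two_div hα hα1.le
  unfold trainSize
  linarith

lemma mul_testSize_le (hα : 0 < α) (hα1 : α ≤ 1) (hε : 0 < ε) (hε1 : ε ≤ 1) :
    α / 40 * (ε / 64) * testSize 1 ε α ≤ 8 * Real.log (2 / α) := by
  have h_ceil := mul_natCeil_le (v := α / 40 * (ε / 64)) (by positivity)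
    (mul_le_one₀ (by linarith) (by positivity) (by linarith)) zero_le_one
    (Real.log_nonneg (one_le_one_div (a := α / 40) (by positivity) (by linarith)))
  unfold testSize
  linarith [log_one_div_div_forty_le hα hα1, half_le_log_two_div hα hα1]

lemma nr2SampleCount_le (hk : 1 ≤ k) (hε : 0 < ε) (hδ : 0 < δ) (hδ1 : δ < 1)
    (hεα : 5 * ε / 4 < α) (hα1 : α < 1) :
    (nr2SampleCount 4 1 k d ε δ α : ℝ) ≤ 154664960000 * (1 / (α ^ 4 * ε) * Real.log (2 * k / δ) *
      (d * Real.log (1 / ε) + k * Real.log (2 / α) + Real.log (1 / δ))) := by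
  have hα : 0 < α := by linarith
  set A := d * Real.log (1 / ε) + k * Real.log (2 / α) + Real.log (1 / δ)
  have h_eps : 0 ≤ d * Real.log (1 / ε) :=
    mul_nonneg d.cast_nonneg (Real.log_nonneg (one_le_one_div hε (by linarith)))
  have h_delta : 0 ≤ Real.log (1 / δ) := Real.log_nonneg (one_le_one_div hδ hδ1.le)
  have h_train := mul_trainSize_le (d := d) hk hε hδ hδ1 hεα hα1
  have h_test := mul_le_mul_of_nonneg_left (mul_testSize_le hα hα1.le hε (by linarith))
    (Nat.cast_nonneg (α := ℝ) k)
  have h_round : (trainSize 4 k d ε δ α : ℝ) + k * testSize 1 ε α ≤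
      118 * A / (α / 40 * (ε / 64)) := by
    rw [le_div_iff₀' (by positivity)]
    linarith
  have h_rounds := numRounds_le_log_two_mul hk hα hα1 hδ hδ1
  rw [nr2SampleCount]
  push_cast
  calc (numRounds k α δ : ℝ) * (trainSize 4 k d ε δ α + k * testSize 1 ε α)
      ≤ 512000 * Real.log (2 * k / δ) / α ^ 3 * (118 * A / (α / 40 * (ε / 64))) :=
        mul_le_mul h_rounds h_round (by positivity) ((Nat.cast_nonneg _).trans h_rounds)
    _ = 154664960000 * (1 / (α ^ 4 * ε) * Real.log (2 * k / δ) * A) := by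
        field_simp
        ring

lemma log_two_mul_le {x : ℝ} (hx : 2 ≤ x) : Real.log (2 * x) ≤ 2 * Real.log x := by
  rw [Real.log_mul two_ne_zero (by positivity), two_mul]
  gcongr

lemma sampleBound_le_of_le_half (hk : 1 ≤ k) (hε : 0 < ε) (hε1 : ε ≤ 1) (hδ : 0 < δ)
    (hδ1 : δ ≤ 1) (hα : 0 < α) (hα_half : α ≤ 1 / 2) (hδk : 2 * δ ≤ k) :
    1 / (α ^ 4 * ε) * Real.log (2 * k / δ) *
      (d * Real.log (1 / ε) + k * Real.log (2 / α) + Real.log (1 / δ)) ≤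
    4 * (1 / (α ^ 4 * ε) * Real.log (k / δ) *
      (d * Real.log (1 / ε) + k * Real.log (1 / α) + Real.log (1 / δ))) := by
  have hk' : (1 : ℝ) ≤ k := mod_cast hk
  have h_players : Real.log (2 * k / δ) ≤ 2 * Real.log (k / δ) := by
    rw [mul_div_assoc]
    exact log_two_mul_le ((le_div_iff₀ hδ).2 hδk)
  have h_alpha : Real.log (2 / α) ≤ 2 * Real.log (1 / α) := by
    rw [div_eq_mul_one_div]
    exact log_two_mul_le ((le_div_iff₀ hα).2 (by linarith))
  have h_eps : 0 ≤ d * Real.log (1 / ε) :=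
    mul_nonneg d.cast_nonneg (Real.log_nonneg (one_le_one_div hε hε1))
  have h_delta : 0 ≤ Real.log (1 / δ) := Real.log_nonneg (one_le_one_div hδ hδ1)
  have h_two : 0 ≤ Real.log (2 / α) := by linarith [half_le_log_two_div hα (by linarith)]
  have h_ratio : 0 ≤ Real.log (k / δ) := Real.log_nonneg ((one_le_div hδ).2 (by linarith))
  have h_sum : d * Real.log (1 / ε) + k * Real.log (2 / α) + Real.log (1 / δ) ≤
      2 * (d * Real.log (1 / ε) + k * Real.log (1 / α) + Real.log (1 / δ)) := by
    linarith [mul_le_mul_of_nonneg_left h_alpha (zero_le_one.trans hk')]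
  calc _ ≤ 1 / (α ^ 4 * ε) * (2 * Real.log (k / δ)) *
        (2 * (d * Real.log (1 / ε) + k * Real.log (1 / α) + Real.log (1 / δ))) := by gcongr
    _ = _ := by ring

end SampleCount

end CollabPAC

end

open MeasureTheory CollabPAC in
theorem theorem4 :
    ∃ C₁ > (0 : ℝ), ∃ C₂ > (0 : ℝ), ∃ C > (0 : ℝ),
      ∀ (k d : ℕ) (ε δ α : ℝ), 1 ≤ k → 0 < ε → ε < 1 → 0 < δ → δ < 1 →
        5 * ε / 4 < α → α < 1 →
        (∀ (X : Type*) [MeasurableSpace X] (F : Set (X → Bool))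
          (O : (n : ℕ) → (Fin n → X × Bool) → X → Bool)
          (D : Fin k → Measure (X × Bool)) [∀ i, IsProbabilityMeasure (D i)],
          (∀ f ∈ F, Measurable f) → vcDim F = d → IsOracle F (ε / 64) O →
          1 - δ ≤ (nr2Law C₁ C₂ d ε δ α O D).real
            {h | ∀ i, err (D i) (nr2Output O h) ≤ (2 + α) * OPT F D + ε}) ∧
        (nr2SampleCount C₁ C₂ k d ε δ α : ℝ) ≤
          C * (1 / (α ^ 4 * ε) * Real.log (2 * k / δ) *
            (d * Real.log (1 / ε) + k * Real.log (2 / α) + Real.log (1 / δ))) ∧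
        (α ≤ 1 / 2 → 2 * δ ≤ k →
          (nr2SampleCount C₁ C₂ k d ε δ α : ℝ) ≤
            C * (1 / (α ^ 4 * ε) * Real.log (k / δ) *
              (d * Real.log (1 / ε) + k * Real.log (1 / α) + Real.log (1 / δ)))) := by
  refine ⟨4, by norm_num, 1, by norm_num, 4 * 154664960000, by norm_num, ?_⟩
  intro k d ε δ α hk hε hε1 hδ hδ1 hεα hα1
  have : NeZero k := ⟨by omega⟩
  have h_count := nr2SampleCount_le (d := d) hk hε hδ hδ1 hεα hα1
  refine ⟨fun X _ F O D _ hF hd hO => ?_, ?_, fun hα hδk => ?_⟩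
  · exact hO.one_sub_le_nr2Law D hF hd.le hε hδ hδ1 hεα hα1
  · have : (0 : ℝ) ≤ nr2SampleCount 4 1 k d ε δ α := Nat.cast_nonneg _
    linarith
  · have h_half := sampleBound_le_of_le_half (d := d) hk hε hε1.le hδ hδ1.le (by linarith) hα hδk
    linarith
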